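/- Let $K$ be a field. A special double poset is a finite set $P$ with a partial order $\leq_1$ and a total order $\leq_2$; they are considered up to isomorphism. Let $\mathbf h_{\mathcal{SP}}$ be the $K$-vector space with basis the set of isomorphism classes of special double posets. It is a Hopf algebra, graded by cardinality, with the following structure. The product $PQ$ is the disjoint union, where elements of $P$ and elements of $Q$ are incomparable for $\leq_1$, and $x\leq_2 y$ for all $x\in P$, $y\in Q$. The coproduct is $\Delta(P)=\sum_I (P\setminus I)\otimes I$, where $I$ runs over the subsets of $P$ that are upper sets for $\leq_1$. The pairing $\langle P,Q\rangle$ is the number of bijections $\sigma:P\to Q$ such that $i\leq_1 j$ implies $\sigma(i)\leq_2\sigma(j)$, and $\sigma(i)\leq_1\sigma(j)$ implies $i\leq_2 j$. Let $\mathbf h_{\mathcal{SPP}}$ be the Hopf subalgebra spanned by the special plane posets, that is, the posets $(P,\leq_h,\leq)$, where $\leq_h,\leq_r$ are two partial orders on $P$ such that any two distinct elements are comparable for exactly one of $\leq_h,\leq_r$, and $x\leq y$ means $x\leq_h y$ or $x\leq_r y$. Let $\mathbf h_{\mathcal{HOF}}$ be the Hopf subalgebra spanned by the heap-ordered forests,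 that is, the special double posets such that $x\leq_1 y$ implies $x\leq_2 y$ and such that the Hasse graph of $\leq_1$ is a rooted forest with its edges oriented from the roots to the leaves. For a special double poset $P$ of cardinality $n$, identify $(P,\leq_2)$ with $\{1<\dots<n\}$, and let $R_P$ be the set of edges of the Hasse graph of $(P,\leq_1)$, an edge $(a,b)$ going from the smaller element $a$ to the larger element $b$. Consider two transformations, where each new poset has the same order $\leq_2$, and its first order is generated by the indicated set of edges. 1. If $(j,i)\in R_P$ and $i<j$, replace $P$ by $P_1-P_2$, where $P_1$ is given by $R_P\setminus\{(j,i)\}$ and $P_2$ by $(R_P\setminus\{(j,i)\})\cup\{(i,j)\}$. 2. If $(i,k),(j,k)\in R_P$ and $i<j<k$, replace $P$ by $P_3-P_4+P_5$, where $P_3$ is given by $R_P\setminus\{(j,k)\}$, $P_4$ by $(R_P\setminus\{(j,k)\})\cup\{(i,j)\}$, and $P_5$ by $(R_P\setminus\{(j,k),(i,k)\})\cup\{(i,j),(j,k)\}$. By applying these transformations repeatedly, one can obtain from $P$ a linear combination of heap-ordered forests, and it does not depend on the way the transformations are performed; denote it by $\Upsilon(P)$, and extend $\Upsilon$ to a linear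 map $\mathbf h_{\mathcal{SP}}\to\mathbf h_{\mathcal{HOF}}$. Then: 1. $\Upsilon|_{\mathbf h_{\mathcal{SPP}}}:\mathbf h_{\mathcal{SPP}}\to\mathbf h_{\mathcal{HOF}}$ is an isomorphism of graded Hopf algebras, and $\langle\Upsilon(x),\Upsilon(y)\rangle=\langle x,y\rangle$ for all $x,y\in\mathbf h_{\mathcal{SPP}}$. 2. The restriction of $\langle-,-\rangle$ to $\mathbf h_{\mathcal{HOF}}$ is nondegenerate. -/

import Mathlib

open scoped TensorProduct

/-- A double poset on the set `α`: two partial orders `≤₁` and `≤₂` on `α`. -/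
structure DoublePoset (α : Type) where
  le₁ : α → α → Prop
  le₂ : α → α → Prop
  refl₁ : ∀ a, le₁ a a
  trans₁ : ∀ {a b c}, le₁ a b → le₁ b c → le₁ a c
  antisymm₁ : ∀ {a b}, le₁ a b → le₁ b a → a = b
  refl₂ : ∀ a, le₂ a a
  trans₂ : ∀ {a b c}, le₂ a b → le₂ b c → le₂ a c
  antisymm₂ : ∀ {a b}, le₂ a b → le₂ b a → a = b

namespace DoublePoset

variable {α β γ δ : Type}

/-- The double poset induced on a subset. -/
@[simps]
def restrict (D : DoublePoset α) (s : Set α) : DoublePoset s where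
  le₁ a b := D.le₁ a b
  le₂ a b := D.le₂ a b
  refl₁ a := D.refl₁ a
  trans₁ := D.trans₁
  antisymm₁ h h' := Subtype.ext (D.antisymm₁ h h')
  refl₂ a := D.refl₂ a
  trans₂ := D.trans₂
  antisymm₂ h h' := Subtype.ext (D.antisymm₂ h h')

/-- The composition of two double posets: on the disjoint union, elements of different components
are incomparable for `≤₁`, and every element of the first component is smaller for `≤₂`
than every element of the second one. -/
@[simps]
def comp (D : DoublePoset α) (E : DoublePoset β) : DoublePoset (α ⊕ β) where
  le₁ := Sum.LiftRel D.le₁ E.le₁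
  le₂ := Sum.Lex D.le₂ E.le₂
  refl₁ := by rintro (a | a) <;> simp [D.refl₁, E.refl₁]
  trans₁ := by
    rintro (a | a) (b | b) (c | c) <;> simp
    · exact D.trans₁
    · exact E.trans₁
  antisymm₁ := by
    rintro (a | a) (b | b) <;> simp
    · exact D.antisymm₁
    · exact E.antisymm₁
  refl₂ := by rintro (a | a) <;> simp [D.refl₂, E.refl₂]
  trans₂ := by
    rintro (a | a) (b | b) (c | c) <;> simp
    · exact D.trans₂
    · exact E.trans₂
  antisymm₂ := by
    rintro (a | a) (b | b) <;> simp
    · exact D.antisymm₂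
    · exact E.antisymm₂

/-- The empty double poset. -/
@[simps]
def empty : DoublePoset Empty where
  le₁ a _ := a.elim
  le₂ a _ := a.elim
  refl₁ a := a.elim
  trans₁ {a} := a.elim
  antisymm₁ {a} := a.elim
  refl₂ a := a.elim
  trans₂ {a} := a.elim
  antisymm₂ {a} := a.elim

/-- A double poset is special if its second order is total. -/
def IsSpecial (D : DoublePoset α) : Prop := ∀ a b, D.le₂ a b ∨ D.le₂ b a

/-- A double poset is plane if two distinct elements are comparable for the first order if, and only
if, they are not comparable for the second one. -/
def IsPlane (D : DoublePoset α) : Prop :=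
  ∀ a b, a ≠ b → ((D.le₁ a b ∨ D.le₁ b a) ↔ ¬ (D.le₂ a b ∨ D.le₂ b a))

/-- A double poset `D` is a plane poset seen as a special poset if there is a plane poset
`(≤ₕ, ≤ᵣ)` on the same set such that `≤₁` is `≤ₕ` and `≤₂` is the induced total order
`x ≤ₕ y or x ≤ᵣ y`. -/
def IsSpecialPlane (D : DoublePoset α) : Prop :=
  ∃ Q : DoublePoset α, Q.IsPlane ∧ (∀ a b, D.le₁ a b ↔ Q.le₁ a b) ∧
    ∀ a b, D.le₂ a b ↔ (Q.le₁ a b ∨ Q.le₂ a b)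

/-- The second order extends the first one. -/
def IsHeapOrdered (D : DoublePoset α) : Prop := ∀ a b, D.le₁ a b → D.le₂ a b

/-- The Hasse graph of `≤₁` is a rooted forest with edges oriented from the roots to the leaves:
the elements below a given element form a chain. -/
def IsForest (D : DoublePoset α) : Prop :=
  ∀ a b c, D.le₁ a c → D.le₁ b c → D.le₁ a b ∨ D.le₁ b a

/-- The Hasse graph of `≤₁`: there is an edge from `i` to `j` if `i ≠ j` and the interval `[i, j]`
is `{i, j}`. -/
def Edge (D : DoublePoset α) (i j : α) : Prop :=
  i ≠ j ∧ {k | D.le₁ i k ∧ D.le₁ k j} = {i, j}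

/-- (`1`-)ideals, that is upper sets for `≤₁`. -/
def IsIdeal (D : DoublePoset α) (I : Set α) : Prop := ∀ a ∈ I, ∀ b, D.le₁ a b → b ∈ I

/-- Pictures between two double posets. -/
def IsPicture (D : DoublePoset α) (E : DoublePoset β) (σ : α ≃ β) : Prop :=
  ∀ i j, (D.le₁ i j → E.le₂ (σ i) (σ j)) ∧ (E.le₁ (σ i) (σ j) → D.le₂ i j)

/-- Isomorphisms of double posets. -/
structure Iso (D : DoublePoset α) (E : DoublePoset β) extends α ≃ β where
  map_le₁ : ∀ a b, E.le₁ (toFun a) (toFun b) ↔ D.le₁ a b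
  map_le₂ : ∀ a b, E.le₂ (toFun a) (toFun b) ↔ D.le₂ a b

namespace Iso

variable {D : DoublePoset α} {E : DoublePoset β} {F : DoublePoset γ} {G : DoublePoset δ}

@[refl] def refl (D : DoublePoset α) : Iso D D where
  toEquiv := Equiv.refl α
  map_le₁ _ _ := Iff.rfl
  map_le₂ _ _ := Iff.rfl

def symm (e : Iso D E) : Iso E D where
  toEquiv := e.toEquiv.symm
  map_le₁ a b := by rw [← e.map_le₁]; exact iff_of_eq (congrArg₂ _ (e.right_inv a) (e.right_inv b))
  map_le₂ a b := by rw [← e.map_le₂]; exact iff_of_eq (congrArg₂ _ (e.right_inv a) (e.right_inv b))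

def trans (e : Iso D E) (f : Iso E F) : Iso D F where
  toEquiv := e.toEquiv.trans f.toEquiv
  map_le₁ a b := (f.map_le₁ _ _).trans (e.map_le₁ a b)
  map_le₂ a b := (f.map_le₂ _ _).trans (e.map_le₂ a b)

def compCongr (e : Iso D F) (f : Iso E G) : Iso (D.comp E) (F.comp G) where
  toEquiv := Equiv.sumCongr e.toEquiv f.toEquiv
  map_le₁ := by
    rintro (a | a) (b | b) <;> simp
    · exact e.map_le₁ a b
    · exact f.map_le₁ a b
  map_le₂ := by
    rintro (a | a) (b | b) <;> simp
    · exact e.map_le₂ a b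
    · exact f.map_le₂ a b

def compAssoc (D : DoublePoset α) (E : DoublePoset β) (F : DoublePoset γ) :
    Iso ((D.comp E).comp F) (D.comp (E.comp F)) where
  toEquiv := Equiv.sumAssoc α β γ
  map_le₁ := by rintro ((a | a) | a) ((b | b) | b) <;> simp
  map_le₂ := by rintro ((a | a) | a) ((b | b) | b) <;> simp

def emptyComp (D : DoublePoset α) : Iso (empty.comp D) D where
  toEquiv := Equiv.emptySum Empty α
  map_le₁ := by rintro (a | a) (b | b) <;> first | exact a.elim | exact b.elim | simp
  map_le₂ := by rintro (a | a) (b | b) <;> first | exact a.elim | exact b.elim | simp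

def compEmpty (D : DoublePoset α) : Iso (D.comp empty) D where
  toEquiv := Equiv.sumEmpty α Empty
  map_le₁ := by rintro (a | a) (b | b) <;> first | exact a.elim | exact b.elim | simp
  map_le₂ := by rintro (a | a) (b | b) <;> first | exact a.elim | exact b.elim | simp

/-- A bijection between two subsets that respects both orders. -/
def restrictOf {s : Set α} {t : Set β} (e : s ≃ t)
    (h₁ : ∀ a b, E.le₁ (e a) (e b) ↔ D.le₁ a b) (h₂ : ∀ a b, E.le₂ (e a) (e b) ↔ D.le₂ a b) :
    Iso (D.restrict s) (E.restrict t) where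
  toEquiv := e
  map_le₁ := h₁
  map_le₂ := h₂

/-- The restriction of an isomorphism. -/
def restrictPreimage (e : Iso D E) (t : Set β) :
    Iso (D.restrict (e.toEquiv ⁻¹' t)) (E.restrict t) where
  toEquiv := e.toEquiv.subtypeEquiv fun _ => Iff.rfl
  map_le₁ a b := e.map_le₁ a b
  map_le₂ a b := e.map_le₂ a b

/-- A subset of a subset. -/
def restrictRestrict (D : DoublePoset α) (s : Set α) (t : Set s) (u : Set α)
    (h : ∀ a, a ∈ u ↔ ∃ ha : a ∈ s, (⟨a, ha⟩ : s) ∈ t) :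
    Iso ((D.restrict s).restrict t) (D.restrict u) where
  toFun a := ⟨a.1.1, (h _).2 ⟨a.1.2, a.2⟩⟩
  invFun a := ⟨⟨a.1, ((h _).1 a.2).1⟩, ((h _).1 a.2).2⟩
  left_inv _ := rfl
  right_inv _ := rfl
  map_le₁ _ _ := Iff.rfl
  map_le₂ _ _ := Iff.rfl

/-- A subset of a disjoint union. -/
def restrictComp (D : DoublePoset α) (E : DoublePoset β) (u : Set (α ⊕ β)) :
    Iso ((D.comp E).restrict u) ((D.restrict (Sum.inl ⁻¹' u)).comp (E.restrict (Sum.inr ⁻¹' u))) where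
  toFun
    | ⟨Sum.inl a, h⟩ => Sum.inl ⟨a, h⟩
    | ⟨Sum.inr a, h⟩ => Sum.inr ⟨a, h⟩
  invFun
    | Sum.inl a => ⟨Sum.inl a, a.2⟩
    | Sum.inr a => ⟨Sum.inr a, a.2⟩
  left_inv := by rintro ⟨a | a, h⟩ <;> rfl
  right_inv := by rintro (a | a) <;> rfl
  map_le₁ := by rintro ⟨a | a, h⟩ ⟨b | b, h'⟩ <;> simp
  map_le₂ := by rintro ⟨a | a, h⟩ ⟨b | b, h'⟩ <;> simp

def restrictUniv (D : DoublePoset α) (s : Set α) (h : ∀ a, a ∈ s) : Iso (D.restrict s) D where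
  toEquiv := Equiv.subtypeUnivEquiv h
  map_le₁ _ _ := Iff.rfl
  map_le₂ _ _ := Iff.rfl

theorem isIdeal_preimage (e : Iso D E) (I : Set β) :
    D.IsIdeal (e.toEquiv ⁻¹' I) ↔ E.IsIdeal I := by
  constructor
  · intro h a ha b hab
    have := h (e.toEquiv.symm a) (by simpa using ha) (e.toEquiv.symm b)
      ((e.symm.map_le₁ a b).2 hab)
    simpa using this
  · intro h a ha b hab
    exact h _ ha _ ((e.map_le₁ a b).2 hab)

theorem isSpecial (e : Iso D E) (h : D.IsSpecial) : E.IsSpecial := fun a b => by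
  have := h (e.toEquiv.symm a) (e.toEquiv.symm b)
  rwa [← e.symm.map_le₂ a b, ← e.symm.map_le₂ b a]

end Iso

theorem IsSpecial.restrict {D : DoublePoset α} (h : D.IsSpecial) (s : Set α) :
    (D.restrict s).IsSpecial := fun a b => h a b

theorem IsSpecial.comp {D : DoublePoset α} {E : DoublePoset β} (h : D.IsSpecial)
    (h' : E.IsSpecial) : (D.comp E).IsSpecial := by
  rintro (a | a) (b | b) <;> simp
  · exact h a b
  · exact h' a b

end DoublePoset

/-- `SPn n` is the set of isoclasses of special double posets of cardinality `n`. The second order of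
a special poset being total, each isoclass has exactly one representative on `{0, …, n - 1}` whose
second order is the usual one (see `SP.iso_std` and `SP.std_eq_iff`). -/
structure SPn (n : ℕ) where
  poset : DoublePoset (Fin n)
  le₂_iff : ∀ a b, poset.le₂ a b ↔ a ≤ b

/-- The set of isoclasses of special double posets. -/
structure SP where
  card : ℕ
  labeled : SPn card

namespace SP

open DoublePoset

variable {α β γ : Type}

/-- The underlying double poset. -/
abbrev poset (P : SP) : DoublePoset (Fin P.card) := P.labeled.poset

theorem isSpecial (P : SP) : P.poset.IsSpecial := fun a b => by
  simpa only [P.labeled.le₂_iff] using le_total a b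

theorem exists_std [Finite α] (D : DoublePoset α) (h : D.IsSpecial) :
    ∃ P : SP, Nonempty (Iso D P.poset) := by
  classical
  let : Fintype α := Fintype.ofFinite α
  let : LinearOrder α :=
    { le := D.le₂
      le_refl := D.refl₂
      le_trans := fun _ _ _ => D.trans₂
      le_antisymm := fun _ _ => D.antisymm₂
      le_total := h
      toDecidableLE := Classical.decRel _ }
  let f : Fin (Fintype.card α) ≃o α :=
    ((Finset.univ : Finset α).orderIsoOfFin rfl).trans
      { toEquiv := Equiv.subtypeUnivEquiv (fun a => Finset.mem_univ a), map_rel_iff' := Iff.rfl }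
  refine ⟨⟨Fintype.card α, ⟨⟨fun a b => D.le₁ (f a) (f b), fun a b => a ≤ b, fun a => D.refl₁ _,
    D.trans₁, fun h h' => f.injective (D.antisymm₁ h h'), fun a => le_rfl, le_trans, le_antisymm⟩,
    fun _ _ => Iff.rfl⟩⟩, ⟨⟨f.symm.toEquiv, ?_, ?_⟩⟩⟩
  · intro a b
    change D.le₁ (f (f.symm a)) (f (f.symm b)) ↔ _
    simp
  · intro a b
    exact f.symm.map_rel_iff'

/-- The isoclass of a finite special double poset. -/
noncomputable def std [Finite α] (D : DoublePoset α) (h : D.IsSpecial) : SP :=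
  (exists_std D h).choose

/-- A finite special double poset is isomorphic to the representative of its isoclass. -/
noncomputable def iso_std [Finite α] (D : DoublePoset α) (h : D.IsSpecial) :
    Iso D (std D h).poset := (exists_std D h).choose_spec.some

theorem eq_of_iso {P Q : SP} (e : Iso P.poset Q.poset) : P = Q := by
  obtain ⟨n, P, hP⟩ := P
  obtain ⟨m, Q, hQ⟩ := Q
  have hnm : n = m := Fin.equiv_iff_eq.1 ⟨e.toEquiv⟩
  subst hnm
  let f : Fin n ≃o Fin n := ⟨e.toEquiv, fun {a b} => by
    exact ((hQ _ _).symm.trans (e.map_le₂ a b)).trans (hP _ _)⟩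
  have hf : ∀ a, e.toEquiv a = a := fun a => by
    have : f = OrderIso.refl _ := Subsingleton.elim _ _
    exact DFunLike.congr_fun this a
  have h₁ : P.le₁ = Q.le₁ := by
    funext a b
    have := e.map_le₁ a b
    change Q.le₁ (e.toEquiv a) (e.toEquiv b) ↔ P.le₁ a b at this
    rw [hf, hf] at this
    exact propext this.symm
  have h₂ : P.le₂ = Q.le₂ := by
    funext a b
    rw [hP, hQ]
  have : P = Q := by
    cases P; cases Q; cases h₁; cases h₂; rfl
  subst this
  rfl

/-- Two finite special double posets have the same representative if, and only if, they are
isomorphic. -/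
theorem std_eq_iff [Finite α] [Finite β] {D : DoublePoset α} {E : DoublePoset β}
    (h : D.IsSpecial) (h' : E.IsSpecial) : std D h = std E h' ↔ Nonempty (Iso D E) := by
  constructor
  · intro H
    exact ⟨(iso_std D h).trans ((H ▸ Iso.refl _ : Iso (std D h).poset (std E h').poset).trans
      (iso_std E h').symm)⟩
  · rintro ⟨e⟩
    exact eq_of_iso ((iso_std D h).symm.trans (e.trans (iso_std E h')))

theorem std_poset (P : SP) : std P.poset P.isSpecial = P := (eq_of_iso (iso_std _ _)).symm

theorem std_congr [Finite α] [Finite β] {D : DoublePoset α} {E : DoublePoset β}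
    (h : D.IsSpecial) (h' : E.IsSpecial) (e : Iso D E) : std D h = std E h' :=
  (std_eq_iff h h').2 ⟨e⟩

theorem card_std [Finite α] (D : DoublePoset α) (h : D.IsSpecial) :
    (std D h).card = Nat.card α := by
  simpa using (Nat.card_congr (iso_std D h).toEquiv).symm

/-- The subposet of `P` with set of elements `s`. -/
noncomputable def sub (P : SP) (s : Set (Fin P.card)) : SP :=
  std (P.poset.restrict s) (P.isSpecial.restrict s)

theorem card_sub (P : SP) (s : Set (Fin P.card)) : (P.sub s).card = Nat.card s := card_std _ _

/-- Special posets form a monoid for the composition. -/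
noncomputable instance : Monoid SP where
  one := std empty (fun a => a.elim)
  mul P Q := std (P.poset.comp Q.poset) (P.isSpecial.comp Q.isSpecial)
  mul_assoc P Q R := by
    apply std_congr
    exact ((iso_std _ _).symm.compCongr (Iso.refl _)).trans
      ((Iso.compAssoc _ _ _).trans ((Iso.refl _).compCongr (iso_std _ _)))
  one_mul P := by
    conv_rhs => rw [← std_poset P]
    apply std_congr
    exact ((iso_std _ _).symm.compCongr (Iso.refl _)).trans (Iso.emptyComp _)
  mul_one P := by
    conv_rhs => rw [← std_poset P]
    apply std_congr
    exact ((Iso.refl _).compCongr (iso_std _ _).symm).trans (Iso.compEmpty _)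

theorem one_def : (1 : SP) = std empty (fun a => a.elim) := rfl

theorem mul_def (P Q : SP) :
    P * Q = std (P.poset.comp Q.poset) (P.isSpecial.comp Q.isSpecial) := rfl

theorem std_mul_std [Finite α] [Finite β] {D : DoublePoset α} {E : DoublePoset β}
    (h : D.IsSpecial) (h' : E.IsSpecial) : std D h * std E h' = std (D.comp E) (h.comp h') :=
  std_congr _ _ ((iso_std _ _).symm.compCongr (iso_std _ _).symm)

theorem card_one : (1 : SP).card = 0 := (card_std _ _).trans Nat.card_of_isEmpty

theorem card_mul (P Q : SP) : (P * Q).card = P.card + Q.card := by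
  exact (card_std _ _).trans (by simp)

theorem eq_one_of_card {P : SP} (h : P.card = 0) : P = 1 := by
  rw [← std_poset P, one_def]
  have : IsEmpty (Fin P.card) := by rw [h]; infer_instance
  exact std_congr _ _ ⟨Equiv.equivOfIsEmpty _ _, fun a => isEmptyElim a, fun a => isEmptyElim a⟩

end SP

/-- A family of special posets containing the empty one and stable under composition and under
taking subposets. -/
structure PosetFamily extends Submonoid SP where
  sub_mem : ∀ P ∈ carrier, ∀ s, P.sub s ∈ carrier

namespace PosetFamily

open DoublePoset SP

instance : Membership SP PosetFamily := ⟨fun C P => P ∈ C.toSubmonoid⟩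

/-- The family defined by a property of double posets which is invariant under isomorphism. -/
def ofProp (p : ∀ {α : Type}, DoublePoset α → Prop)
    (iso : ∀ {α β : Type} {D : DoublePoset α} {E : DoublePoset β}, Iso D E → p D → p E)
    (empty : p empty)
    (comp : ∀ {α β : Type} {D : DoublePoset α} {E : DoublePoset β}, p D → p E → p (D.comp E))
    (restrict : ∀ {α : Type} {D : DoublePoset α} (s : Set α), p D → p (D.restrict s)) :
    PosetFamily where
  carrier := {P | p P.poset}
  one_mem' := iso (iso_std _ _) empty
  mul_mem' hP hQ := iso (iso_std _ _) (comp hP hQ)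
  sub_mem _ hP s := iso (iso_std _ _) (restrict s hP)

/-- All special posets. -/
def special : PosetFamily := ofProp (fun _ => True) (fun _ h => h) trivial (fun _ _ => trivial)
  (fun _ _ => trivial)

theorem mem_special (P : SP) : P ∈ special := trivial

/-- The plane posets, seen as special posets. -/
def specialPlane : PosetFamily := ofProp IsSpecialPlane
  (by
    rintro α β D E e ⟨Q, hQ, h₁, h₂⟩
    refine ⟨⟨fun a b => Q.le₁ (e.toEquiv.symm a) (e.toEquiv.symm b),
      fun a b => Q.le₂ (e.toEquiv.symm a) (e.toEquiv.symm b), fun a => Q.refl₁ _, Q.trans₁,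
      fun h h' => e.toEquiv.symm.injective (Q.antisymm₁ h h'), fun a => Q.refl₂ _, Q.trans₂,
      fun h h' => e.toEquiv.symm.injective (Q.antisymm₂ h h')⟩, ?_, ?_, ?_⟩
    · exact fun a b hab => hQ _ _ (e.toEquiv.symm.injective.ne hab)
    · exact fun a b => (e.symm.map_le₁ a b).symm.trans (h₁ _ _)
    · exact fun a b => (e.symm.map_le₂ a b).symm.trans (h₂ _ _))
  ⟨DoublePoset.empty, fun a => a.elim, fun a => a.elim, fun a => a.elim⟩
  (by
    rintro α β D E ⟨Q, hQ, h₁, h₂⟩ ⟨R, hR, h₁', h₂'⟩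
    refine ⟨Q.comp R, ?_, ?_, ?_⟩
    · rintro (a | a) (b | b) hab <;> simp
      · simpa using hQ a b (by simpa using hab)
      · simpa using hR a b (by simpa using hab)
    · rintro (a | a) (b | b) <;> simp [h₁, h₁']
    · rintro (a | a) (b | b) <;> simp [h₂, h₂'])
  (by
    rintro α D s ⟨Q, hQ, h₁, h₂⟩
    refine ⟨Q.restrict s, ?_, ?_, ?_⟩
    · exact fun a b hab => hQ a b (fun h => hab (Subtype.ext h))
    · exact fun a b => h₁ a b
    · exact fun a b => h₂ a b)

/-- The heap-ordered forests. -/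
def heapOrderedForest : PosetFamily := ofProp (fun D => D.IsHeapOrdered ∧ D.IsForest)
  (by
    rintro α β D E e ⟨h₁, h₂⟩
    refine ⟨fun a b hab => ?_, fun a b c => ?_⟩
    · exact (e.symm.map_le₂ a b).1 (h₁ _ _ ((e.symm.map_le₁ a b).2 hab))
    · rw [← e.symm.map_le₁ a c, ← e.symm.map_le₁ b c, ← e.symm.map_le₁ a b, ← e.symm.map_le₁ b a]
      exact h₂ _ _ _)
  ⟨fun a => a.elim, fun a => a.elim⟩
  (by
    rintro α β D E ⟨h₁, h₂⟩ ⟨h₁', h₂'⟩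
    refine ⟨?_, ?_⟩
    · rintro (a | a) (b | b) <;> simp
      · exact h₁ a b
      · exact h₁' a b
    · rintro (a | a) (b | b) (c | c) <;> simp
      · exact h₂ a b c
      · exact h₂' a b c)
  (fun s ⟨h₁, h₂⟩ => ⟨fun a b => h₁ a b, fun a b c => h₂ a b c⟩)

theorem std_restrict_mem {C : PosetFamily} {α : Type} [Finite α] {D : DoublePoset α}
    {h : D.IsSpecial} (hD : std D h ∈ C) (s : Set α) :
    std (D.restrict s) (h.restrict s) ∈ C := by
  have := C.sub_mem _ hD ((iso_std D h).symm.toEquiv ⁻¹' s)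
  rwa [SP.sub, std_congr _ (h.restrict s) ((iso_std D h).symm.restrictPreimage s)] at this

end PosetFamily

/-- The vector space generated by a family of special posets. It is the algebra of the monoid
formed by the family: the product extends the composition linearly. -/
def HAlg (K : Type*) [CommRing K] (C : PosetFamily) : Type _ := MonoidAlgebra K C.toSubmonoid

namespace HAlg

open DoublePoset SP

section

variable (K : Type*) [CommRing K] (C : PosetFamily)

noncomputable instance : Ring (HAlg K C) := inferInstanceAs (Ring (MonoidAlgebra K C.toSubmonoid))

noncomputable instance : Algebra K (HAlg K C) :=
  inferInstanceAs (Algebra K (MonoidAlgebra K C.toSubmonoid))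

variable {C}

/-- The basis element given by a special poset of the family. -/
noncomputable def of (P : SP) (hP : P ∈ C) : HAlg K C :=
  (MonoidAlgebra.single (⟨P, hP⟩ : C.toSubmonoid) (1 : K) : MonoidAlgebra K C.toSubmonoid)

theorem of_one : of K 1 C.one_mem = (1 : HAlg K C) := rfl

theorem of_mul {P Q : SP} (hP : P ∈ C) (hQ : Q ∈ C) :
    of K P hP * of K Q hQ = of K (P * Q) (C.mul_mem hP hQ) :=
  (MonoidAlgebra.single_mul_single ..).trans (by rw [one_mul]; rfl)

theorem of_congr {P Q : SP} (h : P = Q) (hP : P ∈ C) : of K P hP = of K Q (h ▸ hP) := by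
  subst h; rfl

variable (C)

/-- The basis given by the posets of the family. -/
noncomputable def basis : Module.Basis C.toSubmonoid K (HAlg K C) :=
  ⟨{ toFun := fun x => (x : MonoidAlgebra K C.toSubmonoid).coeff
     map_add' := fun _ _ => rfl
     map_smul' := fun _ _ => rfl
     invFun := MonoidAlgebra.ofCoeff
     left_inv := fun _ => rfl
     right_inv := fun _ => rfl }⟩

variable {C}

theorem basis_apply (P : C.toSubmonoid) : basis K C P = of K P.1 P.2 := rfl

variable {K}

theorem linearMap_ext {M : Type*} [AddCommMonoid M] [Module K M] {f g : HAlg K C →ₗ[K] M}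
    (h : ∀ P hP, f (of K P hP) = g (of K P hP)) : f = g :=
  (basis K C).ext fun P => h P.1 P.2

theorem algHom_ext {A : Type*} [Semiring A] [Algebra K A] {f g : HAlg K C →ₐ[K] A}
    (h : ∀ P hP, f (of K P hP) = g (of K P hP)) : f = g :=
  AlgHom.toLinearMap_injective (linearMap_ext h)

/-- Multiplicative maps extend to algebra morphisms. -/
noncomputable def lift {A : Type*} [Semiring A] [Algebra K A] (f : C.toSubmonoid →* A) :
    HAlg K C →ₐ[K] A := MonoidAlgebra.lift K A C.toSubmonoid f

theorem lift_of {A : Type*} [Semiring A] [Algebra K A] (f : C.toSubmonoid →* A) (P : SP)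
    (hP : P ∈ C) : lift f (of K P hP) = f ⟨P, hP⟩ :=
  (MonoidAlgebra.lift_single ..).trans (one_smul _ _)

end

variable {K : Type*} [CommRing K] {C : PosetFamily}

open Classical in
variable (K) in
/-- The coproduct of a poset: the sum of `(P \ I) ⊗ I` over the ideals `I` of `P`. -/
noncomputable def comulOf (P : SP) (hP : P ∈ C) : HAlg K C ⊗[K] HAlg K C :=
  ∑ I : Set (Fin P.card) with P.poset.IsIdeal I,
    of K (P.sub Iᶜ) (C.sub_mem P hP _) ⊗ₜ[K] of K (P.sub I) (C.sub_mem P hP _)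

open Classical in
theorem comulOf_std {α : Type} [Fintype α] (D : DoublePoset α) (h : D.IsSpecial)
    (hD : std D h ∈ C) : comulOf K (std D h) hD = ∑ I : Set α with D.IsIdeal I,
      of K (std (D.restrict Iᶜ) (h.restrict _)) (PosetFamily.std_restrict_mem hD _) ⊗ₜ[K]
      of K (std (D.restrict I) (h.restrict _)) (PosetFamily.std_restrict_mem hD _) := by
  let e := iso_std D h
  refine Finset.sum_bij' (fun I _ => e.toEquiv ⁻¹' I) (fun I _ => e.toEquiv.symm ⁻¹' I)
    ?_ ?_ ?_ ?_ ?_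
  · intro I hI
    simpa [e.isIdeal_preimage] using hI
  · intro I hI
    exact Finset.mem_filter.2
      ⟨Finset.mem_univ _, (e.symm.isIdeal_preimage I).2 (Finset.mem_filter.1 hI).2⟩
  · intro I _
    ext; simp
  · intro I _
    ext; simp
  · intro I _
    congr 1
    · exact of_congr K (std_congr _ _ (e.restrictPreimage Iᶜ).symm) _
    · exact of_congr K (std_congr _ _ (e.restrictPreimage I).symm) _

open Classical in
theorem comulOf_mul {P Q : SP} (hP : P ∈ C) (hQ : Q ∈ C) :
    comulOf K (P * Q) (C.mul_mem hP hQ) = comulOf K P hP * comulOf K Q hQ := by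
  have h : comulOf K (P * Q) (C.mul_mem hP hQ) = _ :=
    comulOf_std (P.poset.comp Q.poset) (P.isSpecial.comp Q.isSpecial) (C.mul_mem hP hQ)
  rw [h, comulOf, comulOf, Finset.sum_mul_sum, ← Finset.sum_product']
  refine Finset.sum_bij' (fun I _ => (Sum.inl ⁻¹' I, Sum.inr ⁻¹' I))
    (fun J _ => Set.sumEquiv.symm J) ?_ ?_ ?_ ?_ ?_
  · intro I hI
    simp only [Finset.mem_filter, Finset.mem_univ, true_and, Finset.mem_product] at hI ⊢
    exact ⟨fun a ha b hab => hI _ ha (Sum.inl b) (by simpa using hab),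
      fun a ha b hab => hI _ ha (Sum.inr b) (by simpa using hab)⟩
  · rintro ⟨I, J⟩ hIJ
    simp only [Finset.mem_filter, Finset.mem_univ, true_and, Finset.mem_product] at hIJ ⊢
    rintro (a | a) ha (b | b) hab <;> simp at ha hab ⊢
    · exact hIJ.1 a ha b hab
    · exact hIJ.2 a ha b hab
  · intro I _
    exact Set.sumEquiv.symm_apply_apply I
  · intro I _
    exact Set.sumEquiv.apply_symm_apply I
  · intro I _
    rw [Algebra.TensorProduct.tmul_mul_tmul, of_mul, of_mul]
    congr 1
    · refine of_congr K ?_ _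
      rw [SP.sub, SP.sub, std_mul_std]
      exact std_congr _ _ (Iso.restrictComp _ _ _)
    · refine of_congr K ?_ _
      rw [SP.sub, SP.sub, std_mul_std]
      exact std_congr _ _ (Iso.restrictComp _ _ _)

open Classical in
theorem comulOf_one : comulOf K 1 C.one_mem = (1 : HAlg K C ⊗[K] HAlg K C) := by
  have h : comulOf K 1 C.one_mem = _ := comulOf_std (K := K) (C := C) empty (fun a => a.elim) C.one_mem
  rw [h, Finset.sum_eq_single_of_mem (Set.univ : Set Empty)]
  · rw [Algebra.TensorProduct.one_def]
    congr 1
    · exact of_congr K (eq_one_of_card ((card_std _ _).trans Nat.card_of_isEmpty)) _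
    · exact of_congr K (eq_one_of_card ((card_std _ _).trans Nat.card_of_isEmpty)) _
  · exact Finset.mem_filter.2 ⟨Finset.mem_univ _, fun a => a.elim⟩
  · intro I _ hI
    exact absurd (Subsingleton.elim _ _) hI

variable (K C) in
/-- The coproduct. -/
noncomputable def comulHom : HAlg K C →ₐ[K] HAlg K C ⊗[K] HAlg K C :=
  lift
    { toFun := fun P => comulOf K P.1 P.2
      map_one' := comulOf_one
      map_mul' := fun P Q => comulOf_mul P.2 Q.2 }

open Classical in
variable (K C) in
/-- The counit: `1` on the empty poset and `0` on the other ones. -/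
noncomputable def counitHom : HAlg K C →ₐ[K] K :=
  lift
    { toFun := fun P => if P.1.card = 0 then 1 else 0
      map_one' := by simp [card_one]
      map_mul' := fun P Q => by
        by_cases hP : P.1.card = 0 <;> by_cases hQ : Q.1.card = 0 <;> simp [card_mul, hP, hQ] }

theorem comulHom_of (P : SP) (hP : P ∈ C) : comulHom K C (of K P hP) = comulOf K P hP :=
  lift_of _ P hP

open Classical in
theorem counitHom_of (P : SP) (hP : P ∈ C) :
    counitHom K C (of K P hP) = if P.card = 0 then 1 else 0 :=
  lift_of _ P hP

open Classical in
theorem counitHom_sub (P : SP) (s : Set (Fin P.card)) (h : P.sub s ∈ C) :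
    counitHom K C (of K (P.sub s) h) = if s = ∅ then 1 else 0 := by
  rw [counitHom_of, card_sub]
  simp only [Finite.card_eq_zero_iff, Set.isEmpty_coe_sort]

open Classical in
/-- The sum over the chains `I ⊆ L` of two ideals of the tensors `(P \ L) ⊗ (L \ I) ⊗ I`. -/
noncomputable def comul₂Of (P : SP) (hP : P ∈ C) : HAlg K C ⊗[K] (HAlg K C ⊗[K] HAlg K C) :=
  ∑ I : Set (Fin P.card) × Set (Fin P.card) with
      P.poset.IsIdeal I.1 ∧ P.poset.IsIdeal I.2 ∧ I.1 ⊆ I.2,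
    of K (P.sub I.2ᶜ) (C.sub_mem P hP _) ⊗ₜ[K]
      (of K (P.sub (I.2 \ I.1)) (C.sub_mem P hP _) ⊗ₜ[K] of K (P.sub I.1) (C.sub_mem P hP _))

theorem comul_left (P : SP) (hP : P ∈ C) :
    TensorProduct.assoc K _ _ _ (Algebra.TensorProduct.map (comulHom K C) (.id K _)
      (comulOf K P hP)) = comul₂Of P hP := by
  classical
  rw [comulOf, comul₂Of, map_sum, map_sum]
  simp only [Algebra.TensorProduct.map_tmul, comulHom_of, AlgHom.id_apply]
  have h (I : Set (Fin P.card)) : comulOf K (P.sub Iᶜ) (C.sub_mem P hP _) = _ :=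
    comulOf_std (P.poset.restrict Iᶜ) (P.isSpecial.restrict _) (C.sub_mem P hP _)
  simp only [h, TensorProduct.sum_tmul, map_sum, TensorProduct.assoc_tmul]
  rw [Finset.sum_sigma']
  refine Finset.sum_bij'
    (fun x _ => (x.1, x.1 ∪ (Subtype.val '' x.2)))
    (fun x _ => ⟨x.1, Subtype.val ⁻¹' x.2⟩) ?_ ?_ ?_ ?_ ?_
  · rintro ⟨I, J⟩ hIJ
    simp only [Finset.mem_filter, Finset.mem_univ, true_and, Finset.mem_sigma] at hIJ ⊢
    refine ⟨hIJ.1, ?_, Set.subset_union_left⟩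
    rintro a (ha | ⟨a, ha, rfl⟩) b hab
    · exact Or.inl (hIJ.1 a ha b hab)
    · by_cases hb : b ∈ I
      · exact Or.inl hb
      · exact Or.inr ⟨⟨b, hb⟩, hIJ.2 a ha ⟨b, hb⟩ hab, rfl⟩
  · rintro ⟨I, L⟩ hIL
    simp only [Finset.mem_filter, Finset.mem_univ, true_and, Finset.mem_sigma] at hIL ⊢
    exact ⟨hIL.1, fun a ha b hab => hIL.2.1 a ha b hab⟩
  · rintro ⟨I, J⟩ hIJ
    simp only [Sigma.mk.injEq, heq_eq_eq, true_and]
    ext ⟨a, ha⟩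
    simp only [Set.mem_preimage, Set.mem_union, Set.mem_image, Subtype.exists, exists_and_right,
      exists_eq_right]
    constructor
    · rintro (h | ⟨_, h⟩)
      · exact absurd h ha
      · exact h
    · exact fun h => Or.inr ⟨ha, h⟩
  · rintro ⟨I, L⟩ hIL
    simp only [Finset.mem_filter, Finset.mem_univ, true_and] at hIL
    simp only [Prod.mk.injEq, true_and, Subtype.image_preimage_coe]
    ext a
    simp only [Set.mem_union, Set.mem_inter_iff, Set.mem_compl_iff]
    have := @hIL.2.2 a
    tauto
  · rintro ⟨I, J⟩ hIJ
    dsimp only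
    congr 1
    · refine of_congr K (std_congr _ _ (Iso.restrictRestrict _ _ _ _ ?_)) _
      intro a
      simp only [Set.mem_compl_iff, Set.mem_union, Set.mem_image, Subtype.exists, exists_and_right,
        exists_eq_right, not_or, not_exists]
      constructor
      · rintro ⟨h, h'⟩
        exact ⟨h, h' h⟩
      · rintro ⟨h, h'⟩
        exact ⟨h, fun _ => h'⟩
    · congr 1
      refine of_congr K (std_congr _ _ (Iso.restrictRestrict _ _ _ _ ?_)) _
      intro a
      simp only [Set.union_sdiff_left, Set.mem_sdiff, Set.mem_image, Subtype.exists, exists_and_right,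
        exists_eq_right, Set.mem_compl_iff]
      constructor
      · rintro ⟨⟨h, h'⟩, _⟩
        exact ⟨h, h'⟩
      · rintro ⟨h, h'⟩
        exact ⟨⟨h, h'⟩, h⟩

theorem comul_right (P : SP) (hP : P ∈ C) :
    Algebra.TensorProduct.map (.id K _) (comulHom K C) (comulOf K P hP) = comul₂Of P hP := by
  classical
  rw [comulOf, comul₂Of, map_sum]
  simp only [Algebra.TensorProduct.map_tmul, comulHom_of, AlgHom.id_apply]
  have h (I : Set (Fin P.card)) : comulOf K (P.sub I) (C.sub_mem P hP _) = _ :=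
    comulOf_std (P.poset.restrict I) (P.isSpecial.restrict _) (C.sub_mem P hP _)
  simp only [h, TensorProduct.tmul_sum]
  rw [Finset.sum_sigma']
  refine Finset.sum_bij'
    (fun x _ => (Subtype.val '' x.2, x.1))
    (fun x _ => ⟨x.2, Subtype.val ⁻¹' x.1⟩) ?_ ?_ ?_ ?_ ?_
  · rintro ⟨L, J⟩ hIJ
    simp only [Finset.mem_filter, Finset.mem_univ, true_and, Finset.mem_sigma] at hIJ ⊢
    refine ⟨?_, hIJ.1, by simp⟩
    rintro _ ⟨a, ha, rfl⟩ b hab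
    exact ⟨⟨b, hIJ.1 a a.2 b hab⟩, hIJ.2 a ha _ hab, rfl⟩
  · rintro ⟨I, L⟩ hIL
    simp only [Finset.mem_filter, Finset.mem_univ, true_and, Finset.mem_sigma] at hIL ⊢
    exact ⟨hIL.2.1, fun a ha b hab => hIL.1 a ha b hab⟩
  · rintro ⟨I, J⟩ hIJ
    simp only [Sigma.mk.injEq, heq_eq_eq, true_and]
    exact Set.preimage_image_eq _ Subtype.val_injective
  · rintro ⟨I, L⟩ hIL
    simp only [Finset.mem_filter, Finset.mem_univ, true_and] at hIL
    simpa using hIL.2.2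
  · rintro ⟨L, J⟩ hIJ
    dsimp only
    congr 1
    congr 1
    · refine of_congr K (std_congr _ _ (Iso.restrictRestrict _ _ _ _ ?_)) _
      intro a
      simp only [Set.mem_sdiff, Set.mem_image, Subtype.exists, exists_and_right,
        exists_eq_right, Set.mem_compl_iff, not_exists]
      constructor
      · rintro ⟨h, h'⟩
        exact ⟨h, h' h⟩
      · rintro ⟨h, h'⟩
        exact ⟨h, fun _ => h'⟩
    · exact of_congr K (std_congr _ _ (Iso.restrictRestrict _ _ _ _ (by simp))) _

theorem counit_left (P : SP) (hP : P ∈ C) :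
    Algebra.TensorProduct.map (counitHom K C) (.id K _) (comulOf K P hP) = 1 ⊗ₜ of K P hP := by
  classical
  rw [comulOf, map_sum, Finset.sum_eq_single_of_mem Set.univ
    (Finset.mem_filter.2 ⟨Finset.mem_univ _, fun _ _ _ _ => trivial⟩)]
  · rw [Algebra.TensorProduct.map_tmul]
    congr 1
    · rw [counitHom_sub, if_pos (by simp)]
    · refine of_congr K ?_ _
      conv_rhs => rw [← std_poset P]
      exact std_congr _ _ (Iso.restrictUniv _ _ (by simp))
  · intro I _ hI
    rw [Algebra.TensorProduct.map_tmul, counitHom_sub, if_neg, TensorProduct.zero_tmul]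
    rwa [Set.compl_empty_iff]

theorem counit_right (P : SP) (hP : P ∈ C) :
    Algebra.TensorProduct.map (.id K _) (counitHom K C) (comulOf K P hP) = of K P hP ⊗ₜ 1 := by
  classical
  rw [comulOf, map_sum, Finset.sum_eq_single_of_mem ∅
    (Finset.mem_filter.2 ⟨Finset.mem_univ _, fun _ h => h.elim⟩)]
  · rw [Algebra.TensorProduct.map_tmul]
    congr 1
    · refine of_congr K ?_ _
      conv_rhs => rw [← std_poset P]
      exact std_congr _ _ (Iso.restrictUniv _ _ (by simp))
    · rw [counitHom_sub, if_pos (by simp)]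
  · intro I _ hI
    rw [Algebra.TensorProduct.map_tmul, counitHom_sub, if_neg,
      TensorProduct.tmul_zero]
    exact hI

noncomputable instance : Bialgebra K (HAlg K C) :=
  Bialgebra.ofAlgHom (comulHom K C) (counitHom K C)
    (algHom_ext fun P hP => by
      change TensorProduct.assoc K _ _ _ (Algebra.TensorProduct.map (comulHom K C) (.id K _)
        (comulHom K C (of K P hP))) = Algebra.TensorProduct.map (.id K _) (comulHom K C)
        (comulHom K C (of K P hP))
      rw [comulHom_of, comul_left, comul_right])
    (algHom_ext fun P hP => by
      change Algebra.TensorProduct.map (counitHom K C) (.id K _) (comulHom K C (of K P hP)) = _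
      rw [comulHom_of, counit_left]; rfl)
    (algHom_ext fun P hP => by
      change Algebra.TensorProduct.map (.id K _) (counitHom K C) (comulHom K C (of K P hP)) = _
      rw [comulHom_of, counit_right]; rfl)

theorem comul_of (P : SP) (hP : P ∈ C) :
    Coalgebra.comul (R := K) (of K P hP) = comulOf K P hP := comulHom_of P hP

open Classical in
theorem counit_of (P : SP) (hP : P ∈ C) :
    Coalgebra.counit (R := K) (of K P hP) = if P.card = 0 then 1 else 0 := counitHom_of P hP

/-! The antipode is the inverse of the identity for the convolution product; as the bialgebra is
connected, it is given by a geometric series. -/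

open WithConv

variable (K C) in
/-- The map `x ↦ ε(x) 1 - x`, in the convolution algebra. -/
noncomputable def convAux : WithConv (HAlg K C →ₗ[K] HAlg K C) := 1 - toConv LinearMap.id

theorem convAux_pow_of (k : ℕ) (P : SP) (hP : P ∈ C) (h : P.card < k) :
    (convAux K C ^ k) (of K P hP) = 0 := by
  classical
  induction k generalizing P with
  | zero => omega
  | succ k ih =>
    rw [pow_succ', LinearMap.convMul_apply, comul_of, comulOf, map_sum, map_sum]
    refine Finset.sum_eq_zero fun I _ => ?_
    rw [TensorProduct.map_tmul, LinearMap.mul'_apply]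
    by_cases hI : I = Set.univ
    · have h0 : P.sub Iᶜ = 1 := eq_one_of_card (by simp [card_sub, hI])
      have h1 : (convAux K C).ofConv (of K (P.sub Iᶜ) (C.sub_mem P hP _)) = 0 := by
        rw [of_congr K h0]
        change algebraMap K _ (Coalgebra.counit (of K 1 _)) - of K 1 _ = 0
        rw [counit_of, if_pos card_one, map_one, of_one, sub_self]
      rw [h1, zero_mul]
    · have h1 : (convAux K C ^ k).ofConv (of K (P.sub I) (C.sub_mem P hP _)) = 0 := by
        refine ih _ _ ?_
        rw [card_sub]
        have : Nat.card I < Nat.card (Fin P.card) := by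
          rw [Nat.card_coe_set_eq]
          exact Set.ncard_lt_card hI
        rw [Nat.card_fin] at this
        omega
      rw [h1, mul_zero]

variable (K C) in
/-- The antipode. -/
noncomputable def antipodeMap : HAlg K C →ₗ[K] HAlg K C :=
  (basis K C).constr K fun P => ∑ k ∈ Finset.range (P.1.card + 1), (convAux K C ^ k) (basis K C P)

theorem antipodeMap_of (n : ℕ) (P : SP) (hP : P ∈ C) (h : P.card < n) :
    antipodeMap K C (of K P hP) =
      (∑ k ∈ Finset.range n, convAux K C ^ k).ofConv (of K P hP) := by
  have h₁ : antipodeMap K C (of K P hP) = _ := (basis K C).constr_basis K _ ⟨P, hP⟩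
  have h₂ : (∑ k ∈ Finset.range n, convAux K C ^ k).ofConv (of K P hP) =
      ∑ k ∈ Finset.range n, (convAux K C ^ k) (of K P hP) := by
    rw [ofConv_sum, LinearMap.sum_apply]
  rw [h₁, h₂]
  refine Finset.sum_subset (by simpa using h) fun k _ hk => ?_
  exact convAux_pow_of k P hP (by simpa using hk)

theorem antipode_left (P : SP) (hP : P ∈ C) :
    LinearMap.mul' K _ ((antipodeMap K C).rTensor _ (Coalgebra.comul (of K P hP))) =
      algebraMap K _ (Coalgebra.counit (of K P hP)) := by
  classical
  have h := congrArg (fun f => f.ofConv (of K P hP))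
    (geom_sum_mul_neg (convAux K C) (P.card + 1))
  have h1 : (1 - convAux K C) = toConv LinearMap.id := sub_sub_cancel _ _
  simp only [h1] at h
  have h2 : (1 - convAux K C ^ (P.card + 1)).ofConv (of K P hP) =
      algebraMap K _ (Coalgebra.counit (of K P hP)) := by
    change algebraMap K _ (Coalgebra.counit (of K P hP)) - (convAux K C ^ _) (of K P hP) = _
    rw [convAux_pow_of _ _ _ (Nat.lt_succ_self _), sub_zero]
  rw [h2] at h
  rw [← h]
  simp only [LinearMap.convMul_apply]
  rw [comul_of, comulOf]
  simp only [map_sum]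
  refine Finset.sum_congr rfl fun I _ => ?_
  rw [LinearMap.rTensor_tmul, TensorProduct.map_tmul, antipodeMap_of (P.card + 1)]
  · rfl
  · rw [card_sub]
    have := Nat.card_le_card_of_injective (Subtype.val : ↥Iᶜ → _) Subtype.val_injective
    exact Nat.lt_succ_of_le (this.trans_eq (Nat.card_fin _))

theorem antipode_right (P : SP) (hP : P ∈ C) :
    LinearMap.mul' K _ ((antipodeMap K C).lTensor _ (Coalgebra.comul (of K P hP))) =
      algebraMap K _ (Coalgebra.counit (of K P hP)) := by
  classical
  have h := congrArg (fun f => f.ofConv (of K P hP))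
    (mul_neg_geom_sum (convAux K C) (P.card + 1))
  have h1 : (1 - convAux K C) = toConv LinearMap.id := sub_sub_cancel _ _
  simp only [h1] at h
  have h2 : (1 - convAux K C ^ (P.card + 1)).ofConv (of K P hP) =
      algebraMap K _ (Coalgebra.counit (of K P hP)) := by
    change algebraMap K _ (Coalgebra.counit (of K P hP)) - (convAux K C ^ _) (of K P hP) = _
    rw [convAux_pow_of _ _ _ (Nat.lt_succ_self _), sub_zero]
  rw [h2] at h
  rw [← h]
  simp only [LinearMap.convMul_apply]
  rw [comul_of, comulOf]
  simp only [map_sum]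
  refine Finset.sum_congr rfl fun I _ => ?_
  rw [LinearMap.lTensor_tmul, TensorProduct.map_tmul, antipodeMap_of (P.card + 1)]
  · rfl
  · rw [card_sub]
    have := Nat.card_le_card_of_injective (Subtype.val : ↥I → _) Subtype.val_injective
    exact Nat.lt_succ_of_le (this.trans_eq (Nat.card_fin _))

noncomputable instance : HopfAlgebra K (HAlg K C) where
  antipode := antipodeMap K C
  mul_antipode_rTensor_comul := linearMap_ext fun P hP => antipode_left P hP
  mul_antipode_lTensor_comul := linearMap_ext fun P hP => antipode_right P hP

variable (K C) in
/-- The homogeneous component of degree `n`: the span of the posets of cardinality `n`. -/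
noncomputable def homogeneous (n : ℕ) : Submodule K (HAlg K C) :=
  Submodule.span K {x | ∃ (P : SP) (hP : P ∈ C), P.card = n ∧ x = of K P hP}

variable (K C) in
/-- The canonical injection in the Hopf algebra of special posets, as a morphism of algebras. -/
noncomputable def inclAlgHom : HAlg K C →ₐ[K] HAlg K .special :=
  lift
    { toFun := fun P => of K P.1 (PosetFamily.mem_special _)
      map_one' := rfl
      map_mul' := fun _ _ => (of_mul K _ _).symm }

theorem inclAlgHom_of (P : SP) (hP : P ∈ C) :
    inclAlgHom K C (of K P hP) = of K P (PosetFamily.mem_special _) :=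
  lift_of _ P hP

variable (K C) in
/-- The canonical injection in the Hopf algebra of special posets. -/
noncomputable def incl : HAlg K C →ₐc[K] HAlg K .special :=
  BialgHom.ofAlgHom (inclAlgHom K C)
    (algHom_ext fun P hP => by
      classical
      change Coalgebra.counit (inclAlgHom K C (of K P hP)) = Coalgebra.counit (of K P hP)
      rw [inclAlgHom_of, counit_of, counit_of])
    (algHom_ext fun P hP => by
      classical
      change Algebra.TensorProduct.map (inclAlgHom K C) (inclAlgHom K C)
        (Coalgebra.comul (of K P hP)) = Coalgebra.comul (inclAlgHom K C (of K P hP))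
      rw [inclAlgHom_of, comul_of, comul_of, comulOf, comulOf, map_sum]
      simp only [Algebra.TensorProduct.map_tmul, inclAlgHom_of])

theorem incl_of (P : SP) (hP : P ∈ C) :
    incl K C (of K P hP) = of K P (PosetFamily.mem_special _) := inclAlgHom_of P hP

theorem incl_injective : Function.Injective (incl K C) := by
  classical
  let r : HAlg K .special →ₗ[K] HAlg K C := (basis K .special).constr K fun P =>
    if h : P.1 ∈ C then of K P.1 h else 0
  have hr : r ∘ₗ (inclAlgHom K C).toLinearMap = LinearMap.id := linearMap_ext fun P hP => by
    have h : r (of K P (PosetFamily.mem_special _)) = _ :=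
      (basis K .special).constr_basis K _ ⟨P, PosetFamily.mem_special _⟩
    change r (inclAlgHom K C (of K P hP)) = _
    rw [inclAlgHom_of, h, dif_pos hP]
    rfl
  exact Function.LeftInverse.injective (g := r) fun x => LinearMap.congr_fun hr x

variable (K) in
/-- The pairing: `⟨P, Q⟩` is the number of pictures between `P` and `Q`. -/
noncomputable def pairing : HAlg K .special →ₗ[K] HAlg K .special →ₗ[K] K :=
  (basis K .special).constr K fun P => (basis K .special).constr K fun Q =>
    (Nat.card {σ : Fin P.1.card ≃ Fin Q.1.card // P.1.poset.IsPicture Q.1.poset σ} : K)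

variable (K C) in
/-- The restriction of the pairing to the Hopf subalgebra generated by a family. -/
noncomputable def pairingOn : HAlg K C →ₗ[K] HAlg K C →ₗ[K] K :=
  (pairing K).compl₁₂ (incl K C : HAlg K C →ₗ[K] HAlg K .special)
    (incl K C : HAlg K C →ₗ[K] HAlg K .special)

end HAlg

/-- The Hopf algebra of special posets. -/
abbrev HSP (K : Type*) [CommRing K] := HAlg K .special

/-- The Hopf algebra of special plane posets. -/
abbrev HSPP (K : Type*) [CommRing K] := HAlg K .specialPlane

/-- The Hopf algebra of heap-ordered forests. -/
abbrev HHOF (K : Type*) [CommRing K] := HAlg K .heapOrderedForest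

/-- The first order of `Q` is generated by the relation `T`; so the edges of `Q` are the elements of
`T`, after elimination of the redundant ones. -/
def SPn.IsGeneratedBy {n : ℕ} (Q : SPn n) (T : Fin n → Fin n → Prop) : Prop :=
  ∀ a b, Q.poset.le₁ a b ↔ Relation.ReflTransGen T a b

/-- `Reduces K P x` means that `x` is a linear combination of heap-ordered forests obtained
from `P` by repeated application of two transformations, until only heap-ordered forests remain.
* If `(j, i)` is an edge and `i < j`, replace `P` by `P₁ - P₂`: in `P₁` the edge `(j, i)` is deleted,
  in `P₂` it is replaced by `(i, j)`.
* If `(i, k)` and `(j, k)` are edges and `i < j < k`, replace `P` by `P₃ - P₄ + P₅`: in `P₃` the edge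
  `(j, k)` is deleted, in `P₄` it is replaced by `(i, j)`, and in `P₅` the edges `(i, k)` and
  `(j, k)` are replaced by `(i, j)` and `(j, k)`. -/
inductive Reduces (K : Type*) [CommRing K] : ∀ {n : ℕ}, SPn n → HHOF K → Prop
  | forest {n : ℕ} (P : SPn n) (hP : (⟨n, P⟩ : SP) ∈ PosetFamily.heapOrderedForest) :
      Reduces K P (HAlg.of K ⟨n, P⟩ hP)
  | first {n : ℕ} (P P₁ P₂ : SPn n) (i j : Fin n) (x₁ x₂ : HHOF K) (hij : i < j)
      (hji : P.poset.Edge j i)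
      (h₁ : P₁.IsGeneratedBy fun a b => P.poset.Edge a b ∧ (a, b) ≠ (j, i))
      (h₂ : P₂.IsGeneratedBy fun a b => (P.poset.Edge a b ∧ (a, b) ≠ (j, i)) ∨ (a, b) = (i, j))
      (hx₁ : Reduces K P₁ x₁) (hx₂ : Reduces K P₂ x₂) : Reduces K P (x₁ - x₂)
  | second {n : ℕ} (P P₃ P₄ P₅ : SPn n) (i j k : Fin n) (x₃ x₄ x₅ : HHOF K) (hij : i < j)
      (hjk : j < k) (hik : P.poset.Edge i k) (hjk' : P.poset.Edge j k)
      (h₃ : P₃.IsGeneratedBy fun a b => P.poset.Edge a b ∧ (a, b) ≠ (j, k))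
      (h₄ : P₄.IsGeneratedBy fun a b => (P.poset.Edge a b ∧ (a, b) ≠ (j, k)) ∨ (a, b) = (i, j))
      (h₅ : P₅.IsGeneratedBy fun a b =>
        (P.poset.Edge a b ∧ (a, b) ≠ (j, k) ∧ (a, b) ≠ (i, k)) ∨ (a, b) = (i, j) ∨ (a, b) = (j, k))
      (hx₃ : Reduces K P₃ x₃) (hx₄ : Reduces K P₄ x₄) (hx₅ : Reduces K P₅ x₅) :
      Reduces K P (x₃ - x₄ + x₅)

/-! Everything is read off from linear extensions. To a special poset on `Fin n`, the map `theta`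
assigns the sum of the permutations that are increasing from `≤₁` to the natural order, an element
of the free module `PermSpace` on all permutations. A bijection is a picture from `P` to `Q` exactly
when it is a linear extension of `P` and its inverse is a linear extension of `Q`. Hence the pairing
is the pullback along `theta` of the form that makes each permutation dual to its inverse
(`form_theta_of`), and this form is nondegenerate.

Both transformations preserve `theta`: they are identities between indicator functions, obtained by
comparing the values at `i`, `j` and `k` (`ext_first`, `ext_second`). They terminate because a
weight on the edges decreases (`weight_lt`). So the map `Υ` has to be `theta` followed by the
inverse of its restriction to heap-ordered forests, once that restriction is known to be bijective;
this also gives independence of the choices.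

In degree `n` there are at most `n!` heap-ordered forests (each vertex chooses a smaller parent or
none) and at most `n!` special plane posets (each comes from a permutation). It is thus enough that
`theta` is onto for both families. For forests, reduce the total order attached to a permutation,
whose only linear extension is that permutation. For plane posets, the matrix of `theta` is
triangular for inclusion of inversion sets. The dimension count, over a field, gives injectivity
(`repr_eq_zero_of_theta`).

The isomorphism from plane posets to forests commutes with `theta`, hence is an isometry, which
gives its compatibility with the Hopf structure. Splitting the pictures from a composition along
ideals shows that the product is adjoint to the coproduct (`form_theta_mul`). As the form separates
points, this single identity transports both operations; unit, counit and degree are visible on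
`theta`. Nondegeneracy on forests is that of the form. -/

namespace SPn

/-! ### Hasse graphs: deleting and adding edges -/

open DoublePoset Relation

variable {n : ℕ}

/-- A relation that is a partial order on `{0, …, n - 1}`, seen as a special poset. -/
def ofRel (r : Fin n → Fin n → Prop) (hr : ∀ a, r a a) (ht : ∀ {a b c}, r a b → r b c → r a c)
    (ha : ∀ {a b}, r a b → r b a → a = b) : SPn n where
  poset := ⟨r, (· ≤ ·), hr, ht, ha, le_refl, le_trans, le_antisymm⟩
  le₂_iff _ _ := Iff.rfl

theorem ext_le₁ {P Q : SPn n} (h : ∀ a b, P.poset.le₁ a b ↔ Q.poset.le₁ a b) : P = Q := by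
  obtain ⟨⟨r, s, _, _, _, _, _, _⟩, hP⟩ := P
  obtain ⟨⟨r', s', _, _, _, _, _, _⟩, hQ⟩ := Q
  have h₁ : r = r' := by funext a b; exact propext (h a b)
  have h₂ : s = s' := by
    funext a b
    exact propext ((hP a b).trans (hQ a b).symm)
  subst h₁ h₂
  rfl

theorem edge_le₁ {P : SPn n} {a b : Fin n} (h : P.poset.Edge a b) : P.poset.le₁ a b := by
  have : a ∈ {k | P.poset.le₁ a k ∧ P.poset.le₁ k b} := by rw [h.2]; simp
  exact this.2

theorem edge_iff {P : SPn n} {a b : Fin n} : P.poset.Edge a b ↔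
    a ≠ b ∧ P.poset.le₁ a b ∧ ∀ k, P.poset.le₁ a k → P.poset.le₁ k b → k = a ∨ k = b := by
  refine ⟨fun h => ⟨h.1, edge_le₁ h, fun k h₁ h₂ => ?_⟩, fun ⟨h, hab, H⟩ => ⟨h, ?_⟩⟩
  · have : k ∈ {k | P.poset.le₁ a k ∧ P.poset.le₁ k b} := ⟨h₁, h₂⟩
    rw [h.2] at this
    simpa using this
  · ext k
    simp only [Set.mem_ofPred_eq, Set.mem_insert_iff, Set.mem_singleton_iff]
    refine ⟨fun hk => H k hk.1 hk.2, ?_⟩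
    rintro (rfl | rfl)
    · exact ⟨P.poset.refl₁ _, hab⟩
    · exact ⟨hab, P.poset.refl₁ _⟩

/-- The first order is generated by the edges of its Hasse graph. -/
theorem isGeneratedBy_edge (P : SPn n) : P.IsGeneratedBy P.poset.Edge := by
  classical
  intro a b
  constructor
  -- Induction on a bound for the size of the interval `[a, b]`. A strict relation that is not an
  -- edge has a point `k` strictly inside, and `[a, k]` and `[k, b]` are both smaller.
  · suffices H : ∀ m : ℕ, ∀ a b, P.poset.le₁ a b →
        (Finset.univ.filter fun k => P.poset.le₁ a k ∧ P.poset.le₁ k b).card ≤ m →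
        ReflTransGen P.poset.Edge a b from fun h => H _ a b h le_rfl
    intro m
    induction m with
    | zero =>
      intro a b hab h
      exfalso
      have : a ∈ Finset.univ.filter fun k => P.poset.le₁ a k ∧ P.poset.le₁ k b := by
        simp [hab, P.poset.refl₁]
      have := Finset.card_pos.2 ⟨_, this⟩
      omega
    | succ m ih =>
      intro a b hab h
      by_cases hne : a = b
      · exact hne ▸ ReflTransGen.refl
      by_cases he : P.poset.Edge a b
      · exact ReflTransGen.single he
      rw [edge_iff] at he
      push Not at he
      obtain ⟨k, hak, hkb, hka, hkb'⟩ := he hne hab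
      refine (ih a k hak ?_).trans (ih k b hkb ?_) <;>
        refine Nat.le_of_lt_succ (lt_of_lt_of_le (Finset.card_lt_card ?_) h) <;>
        rw [Finset.ssubset_iff_of_subset]
      · exact ⟨b, by simp [hab, P.poset.refl₁],
          by simpa using fun _ h => hkb' (P.poset.antisymm₁ hkb h)⟩
      · intro c
        simpa using fun h h' => ⟨h, P.poset.trans₁ h' hkb⟩
      · exact ⟨a, by simp [hab, P.poset.refl₁],
          by simpa using fun h _ => hka (P.poset.antisymm₁ h hak)⟩
      · intro c
        simpa using fun h h' => ⟨P.poset.trans₁ hak h, h'⟩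
  · intro h
    induction h with
    | refl => exact P.poset.refl₁ _
    | tail _ h ih => exact P.poset.trans₁ ih (edge_le₁ h)

theorem le₁_of_reflTransGen {P : SPn n} {T : Fin n → Fin n → Prop}
    (hT : ∀ a b, T a b → P.poset.Edge a b) {a b : Fin n} (h : ReflTransGen T a b) :
    P.poset.le₁ a b :=
  (P.isGeneratedBy_edge a b).2 (h.lift id hT)

/-- An edge cannot be refined, so each step of a `T`-path along it is a loop at `a` until one jumps
to `b`. This bounds the edges of a transformed poset even when some of the prescribed pairs become
redundant. -/
theorem IsGeneratedBy.of_edge {P : SPn n} {T : Fin n → Fin n → Prop} (hT : P.IsGeneratedBy T)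
    {a b : Fin n} (h : P.poset.Edge a b) : T a b := by
  have hab := (hT a b).1 (edge_le₁ h)
  induction hab using ReflTransGen.head_induction_on with
  | refl => exact absurd rfl h.1
  | head hac hcb ih =>
    rcases (edge_iff.1 h).2.2 _ ((hT _ _).2 (.single hac)) ((hT _ _).2 hcb) with rfl | rfl
    · exact ih h
    · exact hac

/-- The poset obtained by deleting an edge. -/
theorem exists_isGeneratedBy_del (P : SPn n) (e : Fin n × Fin n) :
    ∃ Q : SPn n, Q.IsGeneratedBy fun a b => P.poset.Edge a b ∧ (a, b) ≠ e := by
  refine ⟨ofRel (ReflTransGen fun a b => P.poset.Edge a b ∧ (a, b) ≠ e) (fun _ => .refl)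
    (fun h h' => h.trans h') fun {a b} h h' => P.poset.antisymm₁ ?_ ?_, fun _ _ => Iff.rfl⟩
  · exact le₁_of_reflTransGen (fun _ _ h => h.1) h
  · exact le₁_of_reflTransGen (fun _ _ h => h.1) h'

/-- The poset obtained by adding a pair that creates no cycle. -/
theorem exists_isGeneratedBy_add {Q : SPn n} {T : Fin n → Fin n → Prop} (hT : Q.IsGeneratedBy T)
    {i j : Fin n} (hji : ¬ Q.poset.le₁ j i) :
    ∃ R : SPn n, R.IsGeneratedBy fun a b => T a b ∨ (a, b) = (i, j) := by
  -- A path that uses the new pair reaches `i` from `a` before its first use and leads from `j` to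
  -- `b` after its last one. A cycle through the pair would therefore give `j ≤₁ i` in `Q`.
  have key : ∀ a b, ReflTransGen (fun a b => T a b ∨ (a, b) = (i, j)) a b →
      Q.poset.le₁ a b ∨ (Q.poset.le₁ a i ∧ Q.poset.le₁ j b) := by
    intro a b h
    induction h with
    | refl => exact Or.inl (Q.poset.refl₁ _)
    | tail _ h ih =>
      rcases h with h | h
      · have h := (hT _ _).2 (.single h)
        exact ih.imp (fun ih => Q.poset.trans₁ ih h) fun ih => ⟨ih.1, Q.poset.trans₁ ih.2 h⟩
      · obtain ⟨rfl, rfl⟩ := Prod.mk.inj h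
        exact Or.inr ⟨ih.elim id (·.1), Q.poset.refl₁ _⟩
  refine ⟨ofRel (ReflTransGen fun a b => T a b ∨ (a, b) = (i, j)) (fun _ => .refl)
    (fun h h' => h.trans h') fun {a b} h h' => ?_, fun _ _ => Iff.rfl⟩
  rcases key a b h with h | ⟨h₁, h₂⟩ <;> rcases key b a h' with h' | ⟨h₁', h₂'⟩
  · exact Q.poset.antisymm₁ h h'
  · exact absurd (Q.poset.trans₁ h₂' (Q.poset.trans₁ h h₁')) hji
  · exact absurd (Q.poset.trans₁ h₂ (Q.poset.trans₁ h' h₁)) hji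
  · exact absurd (Q.poset.trans₁ h₂ h₁') hji

/-- The end points of an edge are not comparable any more when the edge is deleted. -/
theorem not_le₁_del {P Q : SPn n} {i j : Fin n} (hji : P.poset.Edge j i)
    (hQ : Q.IsGeneratedBy fun a b => P.poset.Edge a b ∧ (a, b) ≠ (j, i)) :
    ¬ Q.poset.le₁ j i := by
  intro h
  rw [hQ] at h
  rcases ReflTransGen.cases_head h with h | ⟨c, hjc, hci⟩
  · exact hji.1 h
  · have hci := le₁_of_reflTransGen (fun _ _ h => h.1) hci
    rcases (edge_iff.1 hji).2.2 c (edge_le₁ hjc.1) hci with rfl | rfl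
    · exact hjc.1.1 rfl
    · exact hjc.2 rfl

/-! ### Termination of the two transformations -/

/-- A measure of how far a poset is from being a heap-ordered forest: a decreasing edge weighs `n`,
and an increasing edge weighs as much as its end point. -/
noncomputable def weight (P : SPn n) : ℕ :=
  open Classical in
  ∑ e : Fin n × Fin n with P.poset.Edge e.1 e.2, if e.1 < e.2 then e.2.1 else n

/-- The edge `e` is traded for at most the increasing edge `f`, which is lighter: `f` weighs its end
point, which is below `n`, the weight of a decreasing `e`, and below the end point of an increasing
`e` by `hef`. -/
theorem weight_lt {P Q : SPn n} {e f : Fin n × Fin n} (he : P.poset.Edge e.1 e.2)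
    (hf : f.1 < f.2) (hef : e.1 < e.2 → f.2 < e.2)
    (h : ∀ a b, Q.poset.Edge a b → (P.poset.Edge a b ∧ (a, b) ≠ e) ∨ (a, b) = f) :
    Q.weight < P.weight := by
  classical
  let w : Fin n × Fin n → ℕ := fun e => if e.1 < e.2 then e.2.1 else n
  let R : Finset (Fin n × Fin n) := Finset.univ.filter fun e => P.poset.Edge e.1 e.2
  have heR : e ∈ R := by simpa [R] using he
  have hw : w f < w e := by
    simp only [w, if_pos hf]
    split_ifs with h
    · exact hef h
    · exact f.2.2
  calc Q.weight ≤ ∑ x ∈ insert f (R.erase e), w x := by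
        refine Finset.sum_le_sum_of_subset ?_
        rintro ⟨a, b⟩ hab
        simp only [Finset.mem_filter, Finset.mem_univ, true_and] at hab
        simpa [R, or_comm, and_comm] using h a b hab
    _ ≤ w f + ∑ x ∈ R.erase e, w x := by
        by_cases hfR : f ∈ R.erase e
        · rw [Finset.insert_eq_of_mem hfR]; omega
        · rw [Finset.sum_insert hfR]
    _ < w e + ∑ x ∈ R.erase e, w x := by omega
    _ = P.weight := Finset.add_sum_erase R w heR

/-- If a poset is not a heap-ordered forest, one of the two transformations can be performed. -/
theorem exists_edges {P : SPn n} (hP : (⟨n, P⟩ : SP) ∉ PosetFamily.heapOrderedForest) :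
    (∃ i j, i < j ∧ P.poset.Edge j i) ∨
      ∃ i j k, i < j ∧ j < k ∧ P.poset.Edge i k ∧ P.poset.Edge j k := by
  by_cases hinc : ∀ a b, P.poset.Edge a b → a < b
  swap
  · push Not at hinc
    obtain ⟨a, b, h, hba⟩ := hinc
    exact Or.inl ⟨b, a, lt_of_le_of_ne hba h.1.symm, h⟩
  have hheap : P.poset.IsHeapOrdered := by
    intro a b hab
    rw [P.le₂_iff]
    rw [P.isGeneratedBy_edge] at hab
    induction hab with
    | refl => exact le_rfl
    | tail _ h ih => exact ih.trans (hinc _ _ h).le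
  have hforest : ¬ P.poset.IsForest := fun h => hP ⟨hheap, h⟩
  by_contra! H
  refine hforest ?_
  -- Each vertex has at most one parent, so the paths from `a` and `b` to `c` share their last edges
  -- until one of them is exhausted.
  have huniq : ∀ a b c, P.poset.Edge a c → P.poset.Edge b c → a = b := by
    intro a b c ha hb
    by_contra hab
    rcases lt_or_gt_of_ne hab with h | h
    · exact H.2 a b c h (hinc _ _ hb) ha hb
    · exact H.2 b a c h (hinc _ _ ha) hb ha
  intro a b c hac hbc
  rw [P.isGeneratedBy_edge] at hac
  induction hac with
  | refl => exact Or.inr hbc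
  | @tail d c hac hdc ih =>
    rw [P.isGeneratedBy_edge] at hbc
    rcases ReflTransGen.cases_tail hbc with rfl | ⟨e, hbe, hec⟩
    · exact Or.inl ((P.isGeneratedBy_edge _ _).2 (hac.tail hdc))
    · obtain rfl := huniq _ _ _ hec hdc
      exact ih ((P.isGeneratedBy_edge _ _).2 hbe)

/-! ### Linear extensions under the two transformations -/

/-- The order-preserving bijections from `(P, ≤₁)` to `(Fin n, ≤)`. -/
def IsExtension (P : SPn n) (σ : Equiv.Perm (Fin n)) : Prop := ∀ a b, P.poset.le₁ a b → σ a ≤ σ b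

theorem IsGeneratedBy.isExtension_iff {P : SPn n} {T : Fin n → Fin n → Prop}
    (hT : P.IsGeneratedBy T) (σ : Equiv.Perm (Fin n)) :
    P.IsExtension σ ↔ ∀ a b, T a b → σ a ≤ σ b := by
  refine ⟨fun h a b hab => h a b ((hT a b).2 (.single hab)), fun h a b hab => ?_⟩
  rw [hT] at hab
  induction hab with
  | refl => exact le_rfl
  | tail _ hbc ih => exact ih.trans (h _ _ hbc)

/-- The indicator function of the linear extensions. -/
noncomputable def ext (K : Type*) [CommRing K] (P : SPn n) (σ : Equiv.Perm (Fin n)) : K :=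
  open Classical in if P.IsExtension σ then 1 else 0

open Classical in
theorem ext_eq_ite (K : Type*) [CommRing K] {P : SPn n} {σ : Equiv.Perm (Fin n)} {p : Prop}
    (h : P.IsExtension σ ↔ p) : P.ext K σ = if p then 1 else 0 := by
  unfold ext
  by_cases hp : p
  · rw [if_pos hp, if_pos (h.2 hp)]
  · rw [if_neg hp, if_neg (mt h.1 hp)]

/-- The extensions of `P₁` are divided between `P` and `P₂` according to the relative order of `σ i`
and `σ j`, which are distinct. -/
theorem ext_first (K : Type*) [CommRing K] {P P₁ P₂ : SPn n} {i j : Fin n}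
    (hji : P.poset.Edge j i)
    (h₁ : P₁.IsGeneratedBy fun a b => P.poset.Edge a b ∧ (a, b) ≠ (j, i))
    (h₂ : P₂.IsGeneratedBy fun a b => (P.poset.Edge a b ∧ (a, b) ≠ (j, i)) ∨ (a, b) = (i, j))
    (σ : Equiv.Perm (Fin n)) : P.ext K σ = P₁.ext K σ - P₂.ext K σ := by
  have hne : σ i ≠ σ j := σ.injective.ne hji.1.symm
  have e : P.IsExtension σ ↔ P₁.IsExtension σ ∧ σ j ≤ σ i := by
    rw [h₁.isExtension_iff, P.isGeneratedBy_edge.isExtension_iff]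
    refine ⟨fun h => ⟨fun a b hab => h a b hab.1, h j i hji⟩, fun h a b hab => ?_⟩
    by_cases hab' : (a, b) = (j, i)
    · obtain ⟨rfl, rfl⟩ := Prod.mk.inj hab'
      exact h.2
    · exact h.1 a b ⟨hab, hab'⟩
  have e₂ : P₂.IsExtension σ ↔ P₁.IsExtension σ ∧ σ i ≤ σ j := by
    rw [h₁.isExtension_iff, h₂.isExtension_iff]
    refine ⟨fun h => ⟨fun a b hab => h a b (.inl hab), h i j (.inr rfl)⟩, fun h a b hab => ?_⟩
    rcases hab with hab | hab
    · exact h.1 a b hab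
    · obtain ⟨rfl, rfl⟩ := Prod.mk.inj hab
      exact h.2
  rw [ext_eq_ite K e, ext_eq_ite K e₂, ext_eq_ite K Iff.rfl]
  rcases lt_or_gt_of_ne hne with h | h <;> by_cases h' : P₁.IsExtension σ <;>
    simp [h', h.le, h.not_ge]

/-- The constraints `E` from the other edges are common to the four posets. If `σ j < σ i`, then
`P₄` and `P₅` contribute nothing, and `σ i ≤ σ k` already forces `σ j ≤ σ k`, so `P` and `P₃` agree.
If `σ i < σ j`, then `P₃` and `P₄` agree and cancel, and `σ j ≤ σ k` forces `σ i ≤ σ k`, so `P` and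
`P₅` agree. -/
theorem ext_second (K : Type*) [CommRing K] {P P₃ P₄ P₅ : SPn n} {i j k : Fin n}
    (hij : i ≠ j) (hik : P.poset.Edge i k) (hjk : P.poset.Edge j k)
    (h₃ : P₃.IsGeneratedBy fun a b => P.poset.Edge a b ∧ (a, b) ≠ (j, k))
    (h₄ : P₄.IsGeneratedBy fun a b => (P.poset.Edge a b ∧ (a, b) ≠ (j, k)) ∨ (a, b) = (i, j))
    (h₅ : P₅.IsGeneratedBy fun a b =>
      (P.poset.Edge a b ∧ (a, b) ≠ (j, k) ∧ (a, b) ≠ (i, k)) ∨ (a, b) = (i, j) ∨ (a, b) = (j, k))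
    (σ : Equiv.Perm (Fin n)) : P.ext K σ = P₃.ext K σ - P₄.ext K σ + P₅.ext K σ := by
  have hij' : σ i ≠ σ j := σ.injective.ne hij
  let E : Prop := ∀ a b, P.poset.Edge a b → (a, b) ≠ (j, k) → (a, b) ≠ (i, k) → σ a ≤ σ b
  have hmem : ∀ {a b c d : Fin n}, (a, b) = (c, d) → σ c ≤ σ d → σ a ≤ σ b := by
    rintro a b c d h h'
    obtain ⟨rfl, rfl⟩ := Prod.mk.inj h
    exact h'
  have hne : (i, k) ≠ (j, k) := fun h => hij (Prod.mk.inj h).1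
  have e : P.IsExtension σ ↔ E ∧ σ i ≤ σ k ∧ σ j ≤ σ k := by
    rw [P.isGeneratedBy_edge.isExtension_iff]
    refine ⟨fun h => ⟨fun a b hab _ _ => h a b hab, h i k hik, h j k hjk⟩, fun h a b hab => ?_⟩
    by_cases hab' : (a, b) = (j, k)
    · exact hmem hab' h.2.2
    · by_cases hab'' : (a, b) = (i, k)
      · exact hmem hab'' h.2.1
      · exact h.1 a b hab hab' hab''
  have e₃ : P₃.IsExtension σ ↔ E ∧ σ i ≤ σ k := by
    rw [h₃.isExtension_iff]
    refine ⟨fun h => ⟨fun a b hab h' _ => h a b ⟨hab, h'⟩, h i k ⟨hik, hne⟩⟩, fun h a b hab => ?_⟩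
    by_cases hab'' : (a, b) = (i, k)
    · exact hmem hab'' h.2
    · exact h.1 a b hab.1 hab.2 hab''
  have e₄ : P₄.IsExtension σ ↔ E ∧ σ i ≤ σ k ∧ σ i ≤ σ j := by
    rw [h₄.isExtension_iff]
    refine ⟨fun h => ⟨fun a b hab h' _ => h a b (.inl ⟨hab, h'⟩), h i k (.inl ⟨hik, hne⟩),
      h i j (.inr rfl)⟩, fun h a b hab => ?_⟩
    rcases hab with hab | hab
    · by_cases hab'' : (a, b) = (i, k)
      · exact hmem hab'' h.2.1
      · exact h.1 a b hab.1 hab.2 hab''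
    · exact hmem hab h.2.2
  have e₅ : P₅.IsExtension σ ↔ E ∧ σ i ≤ σ j ∧ σ j ≤ σ k := by
    rw [h₅.isExtension_iff]
    refine ⟨fun h => ⟨fun a b hab h' h'' => h a b (.inl ⟨hab, h', h''⟩), h i j (.inr (.inl rfl)),
      h j k (.inr (.inr rfl))⟩, fun h a b hab => ?_⟩
    rcases hab with hab | hab | hab
    · exact h.1 a b hab.1 hab.2.1 hab.2.2
    · exact hmem hab h.2.1
    · exact hmem hab h.2.2
  rw [ext_eq_ite K e, ext_eq_ite K e₃, ext_eq_ite K e₄, ext_eq_ite K e₅]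
  by_cases hE : E
  swap
  · simp [hE]
  simp only [hE, true_and]
  rcases lt_or_gt_of_ne hij' with h | h <;> by_cases h' : σ j ≤ σ k <;> by_cases h'' : σ i ≤ σ k <;>
    simp [h', h'', h.le, h.not_ge]
  · exact absurd (h.le.trans h') h''
  · exact absurd (h.le.trans h'') h'

end SPn

/-- Applying the two transformations as long as possible ends with a linear combination of
heap-ordered forests. -/
theorem Reduces.exists (K : Type*) [CommRing K] {n : ℕ} (P : SPn n) : ∃ x, Reduces K P x := by
  induction hm : P.weight using Nat.strong_induction_on generalizing P with
  | _ m ih =>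
  subst hm
  by_cases hP : (⟨n, P⟩ : SP) ∈ PosetFamily.heapOrderedForest
  · exact ⟨_, .forest P hP⟩
  rcases SPn.exists_edges hP with ⟨i, j, hij, hji⟩ | ⟨i, j, k, hij, hjk, hik, hjk'⟩
  · obtain ⟨P₁, h₁⟩ := P.exists_isGeneratedBy_del (j, i)
    obtain ⟨P₂, h₂⟩ := SPn.exists_isGeneratedBy_add h₁ (SPn.not_le₁_del hji h₁)
    obtain ⟨x₁, hx₁⟩ := ih _ (SPn.weight_lt (e := (j, i)) (f := (i, j)) hji hij
      (fun h => absurd h hij.not_gt) fun a b h => .inl (h₁.of_edge h)) P₁ rfl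
    obtain ⟨x₂, hx₂⟩ := ih _ (SPn.weight_lt (e := (j, i)) (f := (i, j)) hji hij
      (fun h => absurd h hij.not_gt) fun a b h => h₂.of_edge h) P₂ rfl
    exact ⟨_, .first P P₁ P₂ i j x₁ x₂ hij hji h₁ h₂ hx₁ hx₂⟩
  · have hne : (i, k) ≠ (j, k) := fun h => hij.ne (Prod.mk.inj h).1
    obtain ⟨P₃, h₃⟩ := P.exists_isGeneratedBy_del (j, k)
    have hle : ∀ a b, P₃.poset.le₁ a b → P.poset.le₁ a b := fun a b h =>
      SPn.le₁_of_reflTransGen (fun _ _ h => h.1) ((h₃ a b).1 h)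
    -- Otherwise `i` would lie strictly inside the edge `(j, k)`. Hence adding `(i, j)` creates no
    -- cycle.
    have hji : ¬ P.poset.le₁ j i := fun h => by
      rcases (SPn.edge_iff.1 hjk').2.2 i h (SPn.edge_le₁ hik) with h | h
      · exact hij.ne h
      · exact (hij.trans hjk).ne h
    obtain ⟨P₄, h₄⟩ := SPn.exists_isGeneratedBy_add h₃ (i := i) (j := j) fun h => hji (hle _ _ h)
    -- As `(j, k)` is already an edge, `P₅` amounts to trading `(i, k)` for `(i, j)`. In this form
    -- `weight_lt` applies.
    obtain ⟨P₀, h₀⟩ := P.exists_isGeneratedBy_del (i, k)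
    have hle₀ : ∀ a b, P₀.poset.le₁ a b → P.poset.le₁ a b := fun a b h =>
      SPn.le₁_of_reflTransGen (fun _ _ h => h.1) ((h₀ a b).1 h)
    obtain ⟨P₅, h₅⟩ := SPn.exists_isGeneratedBy_add h₀ (i := i) (j := j) fun h => hji (hle₀ _ _ h)
    obtain ⟨x₃, hx₃⟩ := ih _ (SPn.weight_lt (e := (j, k)) (f := (i, j)) hjk' hij
      (fun _ => hjk) fun a b h => .inl (h₃.of_edge h)) P₃ rfl
    obtain ⟨x₄, hx₄⟩ := ih _ (SPn.weight_lt (e := (j, k)) (f := (i, j)) hjk' hij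
      (fun _ => hjk) fun a b h => h₄.of_edge h) P₄ rfl
    obtain ⟨x₅, hx₅⟩ := ih _ (SPn.weight_lt (e := (i, k)) (f := (i, j)) hik hij
      (fun _ => hjk) fun a b h => h₅.of_edge h) P₅ rfl
    have h₅' : P₅.IsGeneratedBy fun a b => (P.poset.Edge a b ∧ (a, b) ≠ (j, k) ∧ (a, b) ≠ (i, k)) ∨
        (a, b) = (i, j) ∨ (a, b) = (j, k) := by
      have : (fun a b => (P.poset.Edge a b ∧ (a, b) ≠ (i, k)) ∨ (a, b) = (i, j)) = fun a b =>
          (P.poset.Edge a b ∧ (a, b) ≠ (j, k) ∧ (a, b) ≠ (i, k)) ∨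
          (a, b) = (i, j) ∨ (a, b) = (j, k) := by
        funext a b
        by_cases hab : (a, b) = (j, k)
        · obtain ⟨rfl, rfl⟩ := Prod.mk.inj hab
          simp [hjk', hne.symm]
        · simp [hab]
      rwa [this] at h₅
    exact ⟨_, .second P P₃ P₄ P₅ i j k x₃ x₄ x₅ hij hjk hik hjk' h₃ h₄ h₅' hx₃ hx₄ hx₅⟩

/-! ### Pictures from a composition -/

namespace DoublePoset

variable {α β γ δ : Type}

theorem IsPicture.iso {D : DoublePoset α} {E : DoublePoset β} {D' : DoublePoset γ}
    {E' : DoublePoset δ} (e : Iso D D') (f : Iso E E') {σ : α ≃ β} (h : D.IsPicture E σ) :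
    D'.IsPicture E' (e.toEquiv.symm.trans (σ.trans f.toEquiv)) := fun i j =>
  ⟨fun hij => (f.map_le₂ _ _).2 ((h _ _).1 ((e.symm.map_le₁ i j).2 hij)),
    fun hij => (e.symm.map_le₂ i j).1 ((h _ _).2 ((f.map_le₁ _ _).1 hij))⟩

/-- The number of pictures between two double posets. -/
noncomputable def numPictures (D : DoublePoset α) (E : DoublePoset β) : ℕ :=
  Nat.card {σ : α ≃ β // D.IsPicture E σ}

theorem numPictures_congr {D : DoublePoset α} {E : DoublePoset β} {D' : DoublePoset γ}
    {E' : DoublePoset δ} (e : Iso D D') (f : Iso E E') :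
    D.numPictures E = D'.numPictures E' := by
  refine Nat.card_congr ⟨fun σ => ⟨_, σ.2.iso e f⟩, fun σ => ⟨_, σ.2.iso e.symm f.symm⟩, ?_, ?_⟩
  · rintro ⟨σ, hσ⟩
    ext a
    simp [Iso.symm]
  · rintro ⟨σ, hσ⟩
    ext a
    simp [Iso.symm]

open Classical in
/-- A bijection from a disjoint union obtained by gluing two bijections. -/
noncomputable def glue (I : Set γ) (σ : α ≃ ↥Iᶜ) (τ : β ≃ I) : α ⊕ β ≃ γ :=
  (Equiv.sumCongr σ τ).trans ((Equiv.sumComm _ _).trans (Equiv.Set.sumCompl I))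

theorem glue_inl (I : Set γ) (σ : α ≃ ↥Iᶜ) (τ : β ≃ I) (a : α) :
    glue I σ τ (Sum.inl a) = σ a := rfl

theorem glue_inr (I : Set γ) (σ : α ≃ ↥Iᶜ) (τ : β ≃ I) (b : β) :
    glue I σ τ (Sum.inr b) = τ b := rfl

/-- Between the two components the only real condition is that no element of `I` is below, for `≤₁`,
an element of the complement; this is what being an ideal means. -/
theorem isPicture_glue {D : DoublePoset α} {E : DoublePoset β} {F : DoublePoset γ} {I : Set γ}
    (hI : F.IsIdeal I) {σ : α ≃ ↥Iᶜ} {τ : β ≃ I} (hσ : D.IsPicture (F.restrict Iᶜ) σ)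
    (hτ : E.IsPicture (F.restrict I) τ) : (D.comp E).IsPicture F (glue I σ τ) := by
  rintro (a | a) (b | b)
  · simpa [glue_inl] using hσ a b
  · simp
  · simp only [comp_le₁, Sum.not_liftRel_inr_inl, false_imp_iff, glue_inr, glue_inl, true_and]
    exact fun h => absurd (hI _ (τ a).2 _ h) (σ b).2
  · simpa [glue_inr] using hτ a b

/-- The ideal is the image of the second component. A relation in `F` leaving it would, by the
picture condition, put an element of the second component below one of the first for `≤₂`. -/
theorem exists_glue {D : DoublePoset α} {E : DoublePoset β} {F : DoublePoset γ} {ρ : α ⊕ β ≃ γ}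
    (hρ : (D.comp E).IsPicture F ρ) : ∃ (I : Set γ) (σ : α ≃ ↥Iᶜ) (τ : β ≃ I), F.IsIdeal I ∧
      D.IsPicture (F.restrict Iᶜ) σ ∧ E.IsPicture (F.restrict I) τ ∧ glue I σ τ = ρ := by
  let I : Set γ := Set.range (ρ ∘ Sum.inr)
  have hinl : ∀ a, ρ (Sum.inl a) ∈ Iᶜ := by
    rintro a ⟨b, hb⟩
    simpa using ρ.injective hb
  let σ : α ≃ ↥Iᶜ := Equiv.ofBijective (fun a => ⟨ρ (Sum.inl a), hinl a⟩) ⟨fun a b h => by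
    simpa using h, fun ⟨c, hc⟩ => by
    obtain ⟨a | b, rfl⟩ := ρ.surjective c
    · exact ⟨a, rfl⟩
    · exact absurd ⟨b, rfl⟩ hc⟩
  let τ : β ≃ I := Equiv.ofInjective _ (ρ.injective.comp Sum.inr_injective)
  refine ⟨I, σ, τ, ?_, ?_, ?_, ?_⟩
  · rintro _ ⟨b, rfl⟩ c hc
    obtain ⟨a | b', rfl⟩ := ρ.surjective c
    · simpa using (hρ (Sum.inr b) (Sum.inl a)).2 hc
    · exact ⟨b', rfl⟩
  · intro a b
    have := hρ (Sum.inl a) (Sum.inl b)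
    rwa [comp_le₁, comp_le₂, Sum.liftRel_inl_inl, Sum.lex_inl_inl] at this
  · intro a b
    have := hρ (Sum.inr a) (Sum.inr b)
    rwa [comp_le₁, comp_le₂, Sum.liftRel_inr_inr, Sum.lex_inr_inr] at this
  · ext (a | a) <;> rfl

open Classical in
/-- A picture from a composition splits in two pictures, to the complement of an ideal and to
this ideal. -/
theorem numPictures_comp [Finite α] [Finite β] [Fintype γ] (D : DoublePoset α) (E : DoublePoset β)
    (F : DoublePoset γ) : (D.comp E).numPictures F = ∑ I : Set γ with F.IsIdeal I,
      D.numPictures (F.restrict Iᶜ) * E.numPictures (F.restrict I) := by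
  have hcard : (D.comp E).numPictures F = Nat.card (Σ I : {I // F.IsIdeal I},
      {σ // D.IsPicture (F.restrict (I.1)ᶜ) σ} × {σ // E.IsPicture (F.restrict I.1) σ}) := by
    symm
    refine Nat.card_congr (Equiv.ofBijective
      (fun x => ⟨glue x.1.1 x.2.1.1 x.2.2.1, isPicture_glue x.1.2 x.2.1.2 x.2.2.2⟩) ⟨?_, ?_⟩)
    · rintro ⟨⟨I, hI⟩, ⟨σ, hσ⟩, ⟨τ, hτ⟩⟩ ⟨⟨J, hJ⟩, ⟨σ', hσ'⟩, ⟨τ', hτ'⟩⟩ h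
      have h : ∀ x, glue I σ τ x = glue J σ' τ' x := fun x =>
        DFunLike.congr_fun (congrArg Subtype.val h) x
      -- The ideal is recovered as the set of values on the second component.
      have hIJ : I = J := by
        ext c
        constructor
        · intro hc
          have := h (Sum.inr (τ.symm ⟨c, hc⟩))
          rw [glue_inr, glue_inr, Equiv.apply_symm_apply] at this
          change c = _ at this
          rw [this]
          exact (τ' _).2
        · intro hc
          have := h (Sum.inr (τ'.symm ⟨c, hc⟩))
          rw [glue_inr, glue_inr, Equiv.apply_symm_apply] at this
          change _ = c at this
          rw [← this]
          exact (τ _).2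
      subst hIJ
      obtain rfl : σ = σ' := Equiv.ext fun a => Subtype.ext (h (Sum.inl a))
      obtain rfl : τ = τ' := Equiv.ext fun a => Subtype.ext (h (Sum.inr a))
      rfl
    · rintro ⟨ρ, hρ⟩
      obtain ⟨I, σ, τ, hI, hσ, hτ, h⟩ := exists_glue hρ
      exact ⟨⟨⟨I, hI⟩, ⟨σ, hσ⟩, ⟨τ, hτ⟩⟩, Subtype.ext h⟩
  let _ : Fintype {I : Set γ // F.IsIdeal I} := Fintype.ofFinite _
  rw [hcard, Nat.card_sigma]
  simp only [Nat.card_prod]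
  exact (Finset.sum_subtype (Finset.univ.filter fun I : Set γ => F.IsIdeal I) (by simp)
    fun I => D.numPictures (F.restrict Iᶜ) * E.numPictures (F.restrict I)).symm

end DoublePoset

open DoublePoset

/-! ### The space of permutations and its nondegenerate form -/

/-- The vector space with basis the set of all permutations. -/
abbrev PermSpace (K : Type*) [CommRing K] : Type _ := (Σ n, Equiv.Perm (Fin n)) →₀ K

namespace PermSpace

variable {K : Type*} [CommRing K]

/-- The inverse of a permutation. -/
def inv (s : Σ n, Equiv.Perm (Fin n)) : Σ n, Equiv.Perm (Fin n) := ⟨s.1, s.2⁻¹⟩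

theorem inv_inv (s : Σ n, Equiv.Perm (Fin n)) : inv (inv s) = s := Sigma.ext rfl (heq_of_eq (_root_.inv_inv s.2))

variable (K) in
/-- The bilinear form for which the inverse of a permutation is dual to this permutation. -/
noncomputable def form : PermSpace K →ₗ[K] PermSpace K →ₗ[K] K :=
  Finsupp.linearCombination K fun s => Finsupp.lapply (inv s)

theorem form_single_left (s : Σ n, Equiv.Perm (Fin n)) (f : PermSpace K) :
    form K (Finsupp.single s 1) f = f (inv s) := by
  simp [form]

theorem form_single_right (s : Σ n, Equiv.Perm (Fin n)) (f : PermSpace K) :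
    form K f (Finsupp.single s 1) = f (inv s) := by
  classical
  have : (form K).flip (Finsupp.single s 1) = Finsupp.lapply (inv s) := by
    ext t
    simp only [form, LinearMap.coe_comp, Function.comp_apply, Finsupp.lsingle_apply,
      LinearMap.flip_apply, Finsupp.linearCombination_single, one_smul, Finsupp.lapply_apply,
      Finsupp.single_apply]
    have : s = inv t ↔ t = inv s := ⟨fun h => by rw [h, inv_inv], fun h => by rw [h, inv_inv]⟩
    simp only [this]
  exact LinearMap.congr_fun this f

/-- The coefficient at `s` is the value of the form against the inverse of `s`. -/
theorem eq_of_form_left {f g : PermSpace K} (h : ∀ z, form K f z = form K g z) : f = g := by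
  ext s
  simpa [form_single_right, inv_inv] using h (Finsupp.single (inv s) 1)

theorem eq_of_form_right {f g : PermSpace K} (h : ∀ z, form K z f = form K z g) : f = g := by
  ext s
  simpa [form_single_left, inv_inv] using h (Finsupp.single (inv s) 1)

/-- The tensor product of two linear forms. -/
noncomputable def tmulForm {M N : Type*} [AddCommGroup M] [Module K M] [AddCommGroup N] [Module K N]
    (f : M →ₗ[K] K) (g : N →ₗ[K] K) : M ⊗[K] N →ₗ[K] K :=
  LinearMap.mul' K K ∘ₗ TensorProduct.map f g

theorem tmulForm_tmul {M N : Type*} [AddCommGroup M] [Module K M] [AddCommGroup N] [Module K N]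
    (f : M →ₗ[K] K) (g : N →ₗ[K] K) (x : M) (y : N) : tmulForm f g (x ⊗ₜ y) = f x * g y := by
  simp [tmulForm]

theorem tmulForm_map {M N M' N' : Type*} [AddCommGroup M] [Module K M] [AddCommGroup N] [Module K N]
    [AddCommGroup M'] [Module K M'] [AddCommGroup N'] [Module K N']
    (f : M →ₗ[K] K) (g : N →ₗ[K] K) (u : M' →ₗ[K] M) (v : N' →ₗ[K] N) (x : M' ⊗[K] N') :
    tmulForm f g (TensorProduct.map u v x) = tmulForm (f ∘ₗ u) (g ∘ₗ v) x := by
  rw [tmulForm, tmulForm, TensorProduct.map_comp]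
  rfl

/-- The tensor products of forms separate the points of the tensor square. -/
theorem tensor_eq_of_form {t u : PermSpace K ⊗[K] PermSpace K}
    (h : ∀ f g, tmulForm (form K f) (form K g) t = tmulForm (form K f) (form K g) u) : t = u := by
  let b : Module.Basis (Σ n, Equiv.Perm (Fin n)) K (PermSpace K) := Finsupp.basisSingleOne
  refine (b.tensorProduct b).ext_elem fun ⟨i, j⟩ => ?_
  have key : ∀ t, (b.tensorProduct b).repr t (i, j) = tmulForm
      (form K (Finsupp.single (inv i) 1)) (form K (Finsupp.single (inv j) 1)) t := by
    intro t
    induction t with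
    | zero => simp
    | add x y hx hy => rw [map_add, map_add, Finsupp.add_apply, hx, hy]
    | tmul x y =>
      rw [tmulForm_tmul, form_single_left, form_single_left, inv_inv, inv_inv,
        Module.Basis.tensorProduct_repr_tmul_apply]
      simp [b, mul_comm]
  rw [key, key, h]

end PermSpace

/-! ### The map `theta` and the Hopf pairing -/

namespace HAlg

open PermSpace

variable {K : Type*} [CommRing K] {C C' : PosetFamily}

@[elab_as_elim]
theorem induction {p : HAlg K C → Prop} (of : ∀ P hP, p (of K P hP))
    (add : ∀ x y, p x → p y → p (x + y)) (smul : ∀ (a : K) x, p x → p (a • x)) (x : HAlg K C) :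
    p x := by
  have hx : x ∈ Submodule.span K (Set.range (basis K C)) := by
    rw [(basis K C).span_eq]; trivial
  induction hx using Submodule.span_induction with
  | mem x hx =>
    obtain ⟨P, rfl⟩ := hx
    exact of P.1 P.2
  | zero => simpa using smul 0 _ (of 1 C.one_mem)
  | add x y _ _ hx hy => exact add x y hx hy
  | smul a x _ hx => exact smul a x hx

variable (K C) in
/-- The sum of the linear extensions of a special poset, seen as permutations. -/
noncomputable def theta : HAlg K C →ₗ[K] PermSpace K :=
  (basis K C).constr K fun P => Finsupp.embDomain (Function.Embedding.sigmaMk P.1.card)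
    (Finsupp.equivFunOnFinite.symm (P.1.labeled.ext K))

theorem theta_of (P : SP) (hP : P ∈ C) :
    theta K C (of K P hP) = Finsupp.embDomain (Function.Embedding.sigmaMk P.card)
      (Finsupp.equivFunOnFinite.symm (P.labeled.ext K)) :=
  (basis K C).constr_basis K _ ⟨P, hP⟩

theorem theta_of_apply {n : ℕ} (P : SPn n) (hP : (⟨n, P⟩ : SP) ∈ C) (σ : Equiv.Perm (Fin n)) :
    theta K C (of K ⟨n, P⟩ hP) ⟨n, σ⟩ = P.ext K σ := by
  rw [theta_of]
  exact Finsupp.embDomain_apply_self _ _ σ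

theorem theta_of_apply_of_ne {n : ℕ} (P : SP) (hP : P ∈ C) (h : P.card ≠ n)
    (σ : Equiv.Perm (Fin n)) : theta K C (of K P hP) ⟨n, σ⟩ = 0 := by
  rw [theta_of]
  refine Finsupp.embDomain_of_notMem_range _ _ _ ?_
  rintro ⟨τ, hτ⟩
  exact h (congrArg Sigma.fst hτ)

theorem theta_incl (x : HAlg K C) : theta K .special (incl K C x) = theta K C x := by
  induction x using HAlg.induction with
  | of P hP => rw [incl_of, theta_of, theta_of]
  | add x y hx hy => rw [map_add, map_add, map_add, hx, hy]
  | smul a x hx => rw [map_smul, map_smul, map_smul, hx]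

/-- The form on permutations counts the pictures. -/
theorem form_theta_of (P Q : SP) (hP : P ∈ C) (hQ : Q ∈ C') :
    form K (theta K C (of K P hP)) (theta K C' (of K Q hQ)) = (P.poset.numPictures Q.poset : K) := by
  classical
  obtain ⟨n, P⟩ := P
  obtain ⟨m, Q⟩ := Q
  rw [theta_of, form, Finsupp.linearCombination_embDomain, Finsupp.linearCombination_apply,
    Finsupp.sum_fintype _ _ (by simp), LinearMap.sum_apply]
  by_cases hnm : n = m
  · subst hnm
    rw [numPictures, Nat.card_eq_fintype_card, Fintype.card_subtype, ← Finset.sum_boole]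
    refine Finset.sum_congr rfl fun σ _ => ?_
    change P.ext K σ * theta K C' (of K ⟨n, Q⟩ hQ) ⟨n, σ⁻¹⟩ = _
    rw [theta_of_apply, SPn.ext, SPn.ext, ite_zero_mul_ite_zero, one_mul]
    -- Since both second orders are the natural one, the two halves of the picture condition say
    -- that `σ` extends `P` and that `σ⁻¹` extends `Q`.
    refine if_congr ?_ rfl rfl
    constructor
    · rintro ⟨h, h'⟩ i j
      refine ⟨fun hij => (Q.le₂_iff _ _).2 (h i j hij), fun hij => (P.le₂_iff _ _).2 ?_⟩
      simpa using h' _ _ hij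
    · intro h
      refine ⟨fun i j hij => (Q.le₂_iff _ _).1 ((h i j).1 hij), fun i j hij => ?_⟩
      refine (P.le₂_iff _ _).1 ((h _ _).2 ?_)
      simpa using hij
  · have : IsEmpty (Fin n ≃ Fin m) := ⟨fun e => hnm (Fin.equiv_iff_eq.1 ⟨e⟩)⟩
    rw [numPictures, Nat.card_of_isEmpty, Nat.cast_zero]
    refine Finset.sum_eq_zero fun σ _ => ?_
    change P.ext K σ * theta K C' (of K ⟨m, Q⟩ hQ) ⟨n, σ⁻¹⟩ = 0
    rw [theta_of_apply_of_ne _ _ (Ne.symm hnm), mul_zero]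

theorem pairing_eq (x y : HSP K) :
    pairing K x y = form K (theta K .special x) (theta K .special y) := by
  have : pairing K = (form K).compl₁₂ (theta K .special) (theta K .special) := by
    refine linearMap_ext fun P hP => linearMap_ext fun Q hQ => ?_
    rw [LinearMap.compl₁₂_apply, form_theta_of]
    have h : pairing K (of K P hP) = _ := (basis K .special).constr_basis K _ ⟨P, hP⟩
    rw [h]
    exact (basis K .special).constr_basis K _ ⟨Q, hQ⟩
  rw [this]
  rfl

theorem pairingOn_eq (x y : HAlg K C) :
    pairingOn K C x y = form K (theta K C x) (theta K C y) := by
  rw [← theta_incl x, ← theta_incl y, ← pairing_eq]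
  rfl

/-- The pairing is a Hopf pairing. -/
theorem form_theta_mul (x y : HAlg K C) (z : HAlg K C') :
    form K (theta K C (x * y)) (theta K C' z) =
      tmulForm (form K (theta K C x) ∘ₗ theta K C') (form K (theta K C y) ∘ₗ theta K C')
        (Coalgebra.comul z) := by
  classical
  induction x using HAlg.induction with
  | add x x' hx hx' =>
    simp only [add_mul, map_add, LinearMap.add_apply, hx, hx', tmulForm, LinearMap.add_comp,
      TensorProduct.map_add_left, LinearMap.comp_add]
  | smul a x hx =>
    simp only [smul_mul_assoc, map_smul, LinearMap.smul_apply, hx, tmulForm, LinearMap.smul_comp,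
      TensorProduct.map_smul_left, LinearMap.comp_smul]
  | of P hP =>
  induction y using HAlg.induction with
  | add x x' hx hx' =>
    simp only [mul_add, map_add, LinearMap.add_apply, hx, hx', tmulForm, LinearMap.add_comp,
      TensorProduct.map_add_right, LinearMap.comp_add]
  | smul a x hx =>
    simp only [mul_smul_comm, map_smul, LinearMap.smul_apply, hx, tmulForm, LinearMap.smul_comp,
      TensorProduct.map_smul_right, LinearMap.comp_smul]
  | of Q hQ =>
  induction z using HAlg.induction with
  | add x x' hx hx' => simp only [map_add, hx, hx']
  | smul a x hx => simp only [map_smul, hx]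
  | of R hR =>
    rw [of_mul, form_theta_of, comul_of, comulOf, map_sum]
    simp only [tmulForm_tmul, LinearMap.comp_apply, form_theta_of]
    have h : (P * Q).poset.numPictures R.poset = (P.poset.comp Q.poset).numPictures R.poset :=
      numPictures_congr (SP.iso_std _ _).symm (Iso.refl _)
    -- The same ideals of `R` index the terms of its coproduct and the splittings of the pictures
    -- from the composition, so the sums match term by term.
    rw [h, numPictures_comp, Nat.cast_sum]
    refine Finset.sum_congr rfl fun I _ => ?_
    rw [Nat.cast_mul]
    congr 2
    · exact numPictures_congr (Iso.refl _) (SP.iso_std _ _)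
    · exact numPictures_congr (Iso.refl _) (SP.iso_std _ _)

theorem theta_one_eq : theta K C 1 = theta K C' 1 := by
  rw [← of_one, ← of_one, theta_of, theta_of]

/-- Only the empty poset has a component on the empty permutation. Thus a map compatible with
`theta` preserves the counit. -/
theorem theta_apply_zero (x : HAlg K C) :
    theta K C x ⟨0, 1⟩ = Coalgebra.counit (R := K) x := by
  classical
  induction x using HAlg.induction with
  | of P hP =>
    rw [counit_of]
    split_ifs with h
    · obtain ⟨n, P⟩ := P
      obtain rfl : n = 0 := h
      rw [theta_of_apply, SPn.ext, if_pos]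
      exact fun a => a.elim0
    · exact theta_of_apply_of_ne _ _ h _
  | add x y hx hy => rw [map_add, map_add, Finsupp.add_apply, hx, hy]
  | smul a x hx => rw [map_smul, map_smul, Finsupp.smul_apply, hx]

/-- Each transformation preserves the sum of linear extensions. Together with the injectivity of
`theta` on forests, this makes the outcome of a reduction unique. -/
theorem theta_eq_of_reduces {n : ℕ} {P : SPn n} {x : HHOF K} (h : Reduces K P x) :
    theta K .heapOrderedForest x =
      theta K .special (of K ⟨n, P⟩ (PosetFamily.mem_special _)) := by
  have key : ∀ {n : ℕ} {P : SPn n} {f : PermSpace K}, (∀ σ, f ⟨n, σ⟩ = P.ext K σ) →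
      (∀ m (σ : Equiv.Perm (Fin m)), n ≠ m → f ⟨m, σ⟩ = 0) →
      f = theta K .special (of K ⟨n, P⟩ (PosetFamily.mem_special _)) := by
    intro n P f h h'
    ext ⟨m, σ⟩
    by_cases hm : n = m
    · subst hm
      rw [theta_of_apply, h]
    · rw [theta_of_apply_of_ne _ _ hm, h' m σ hm]
  induction h with
  | forest P hP => rw [theta_of, theta_of]
  | first P P₁ P₂ i j x₁ x₂ hij hji h₁ h₂ hx₁ hx₂ ih₁ ih₂ =>
    rw [map_sub, ih₁, ih₂]
    refine key (fun σ => ?_) fun m σ hm => ?_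
    · rw [Finsupp.sub_apply, theta_of_apply, theta_of_apply, SPn.ext_first K hji h₁ h₂]
    · rw [Finsupp.sub_apply, theta_of_apply_of_ne _ _ hm, theta_of_apply_of_ne _ _ hm, sub_zero]
  | second P P₃ P₄ P₅ i j k x₃ x₄ x₅ hij hjk hik hjk' h₃ h₄ h₅ hx₃ hx₄ hx₅ ih₃ ih₄ ih₅ =>
    rw [map_add, map_sub, ih₃, ih₄, ih₅]
    refine key (fun σ => ?_) fun m σ hm => ?_
    · rw [Finsupp.add_apply, Finsupp.sub_apply, theta_of_apply, theta_of_apply, theta_of_apply,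
        SPn.ext_second K hij.ne hik hjk' h₃ h₄ h₅]
    · rw [Finsupp.add_apply, Finsupp.sub_apply, theta_of_apply_of_ne _ _ hm,
        theta_of_apply_of_ne _ _ hm, theta_of_apply_of_ne _ _ hm, sub_zero, add_zero]

end HAlg

/-- The permutation `τ ∘ σ⁻¹` is an order automorphism of a finite chain, hence the identity. -/
theorem Equiv.Perm.eq_of_forall_le {n : ℕ} {σ τ : Equiv.Perm (Fin n)}
    (h : ∀ a b, σ a ≤ σ b → τ a ≤ τ b) : τ = σ := by
  have hm : Monotone (σ.symm.trans τ) := fun a b hab => h _ _ (by simpa using hab)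
  let f : Fin n ≃o Fin n := StrictMono.orderIsoOfSurjective (σ.symm.trans τ)
    (hm.strictMono_of_injective (σ.symm.trans τ).injective) (σ.symm.trans τ).surjective
  have hf : f = OrderIso.refl _ := Subsingleton.elim _ _
  ext a
  have : f (σ a) = σ a := by rw [hf]; rfl
  rw [← this]
  simp [f]

/-! ### Counting plane posets and heap-ordered forests -/

namespace SPn

variable {n : ℕ}

instance : Finite (SPn n) :=
  Finite.of_injective (fun P : SPn n => P.poset.le₁) fun _ _ h =>
    ext_le₁ fun a b => iff_of_eq (congrFun (congrFun h a) b)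

/-- The special poset whose first order is the total order given by a permutation. -/
def ofPerm (σ : Equiv.Perm (Fin n)) : SPn n :=
  ofRel (fun a b => σ a ≤ σ b) (fun _ => le_rfl) (fun h h' => h.trans h')
    fun h h' => σ.injective (le_antisymm h h')

theorem isExtension_ofPerm (σ τ : Equiv.Perm (Fin n)) : (ofPerm σ).IsExtension τ ↔ τ = σ :=
  ⟨fun h => Equiv.Perm.eq_of_forall_le h, fun h _ _ hab => h ▸ hab⟩

/-- The special plane poset whose first order is the intersection of the natural order
and of the total order given by a permutation. -/
def planeOfPerm (σ : Equiv.Perm (Fin n)) : SPn n :=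
  ofRel (fun a b => a ≤ b ∧ σ a ≤ σ b) (fun _ => ⟨le_rfl, le_rfl⟩)
    (fun h h' => ⟨h.1.trans h'.1, h.2.trans h'.2⟩) fun h h' => le_antisymm h.1 h'.1

theorem planeOfPerm_mem (σ : Equiv.Perm (Fin n)) :
    (⟨n, planeOfPerm σ⟩ : SP) ∈ PosetFamily.specialPlane := by
  refine ⟨⟨fun a b => a ≤ b ∧ σ a ≤ σ b, fun a b => a ≤ b ∧ σ b ≤ σ a, fun _ => ⟨le_rfl, le_rfl⟩,
    fun h h' => ⟨h.1.trans h'.1, h.2.trans h'.2⟩, fun h h' => le_antisymm h.1 h'.1,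
    fun _ => ⟨le_rfl, le_rfl⟩, fun h h' => ⟨h.1.trans h'.1, h'.2.trans h.2⟩,
    fun h h' => le_antisymm h.1 h'.1⟩, fun a b hab => ?_, fun a b => Iff.rfl, fun a b => ?_⟩
  · have hσ : σ a ≠ σ b := σ.injective.ne hab
    rcases lt_or_gt_of_ne hab with h | h <;> rcases lt_or_gt_of_ne hσ with h' | h' <;>
      simp [h.le, h.not_ge, h'.le, h'.not_ge]
  · change a ≤ b ↔ (a ≤ b ∧ σ a ≤ σ b) ∨ (a ≤ b ∧ σ b ≤ σ a)
    have := le_total (σ a) (σ b)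
    tauto

/-- Every special plane poset is given by a permutation. -/
theorem exists_planeOfPerm {P : SPn n} (hP : (⟨n, P⟩ : SP) ∈ PosetFamily.specialPlane) :
    ∃ σ, planeOfPerm σ = P := by
  obtain ⟨Q, hQ, h₁, h₂⟩ := hP
  have hpl : ∀ {a b}, (Q.le₁ a b ∨ Q.le₁ b a) → (Q.le₂ a b ∨ Q.le₂ b a) → a = b := by
    intro a b h h'
    by_contra hab
    exact (hQ a b hab).1 h h'
  have htot : ∀ a b, (Q.le₁ a b ∨ Q.le₁ b a) ∨ (Q.le₂ a b ∨ Q.le₂ b a) := by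
    intro a b
    by_cases hab : a = b
    · exact .inl (.inl (hab ▸ Q.refl₁ a))
    · have := hQ a b hab
      tauto
  -- Mixed cases of transitivity for the relation "`a ≤ₕ b` or `b ≤ᵣ a`": any other position of `a`
  -- and `c` makes two elements comparable for both orders, hence equal.
  have hmix : ∀ {a b c}, Q.le₁ a b → Q.le₂ c b → Q.le₁ a c ∨ Q.le₂ c a := by
    intro a b c hab hcb
    rcases htot a c with (h | h) | (h | h)
    · exact .inl h
    · obtain rfl := hpl (.inl (Q.trans₁ h hab)) (.inl hcb)
      exact .inl hab
    · obtain rfl := hpl (.inl hab) (.inl (Q.trans₂ h hcb))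
      exact .inr hcb
    · exact .inr h
  have hmix' : ∀ {a b c}, Q.le₂ b a → Q.le₁ b c → Q.le₁ a c ∨ Q.le₂ c a := by
    intro a b c hba hbc
    rcases htot a c with (h | h) | (h | h)
    · exact .inl h
    · obtain rfl := hpl (.inl (Q.trans₁ hbc h)) (.inl hba)
      exact .inl hbc
    · obtain rfl := hpl (.inl hbc) (.inl (Q.trans₂ hba h))
      exact .inr hba
    · exact .inr h
  let D : DoublePoset (Fin n) :=
    { le₁ := Eq
      le₂ := fun a b => Q.le₁ a b ∨ Q.le₂ b a
      refl₁ := fun _ => rfl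
      trans₁ := Eq.trans
      antisymm₁ := fun h _ => h
      refl₂ := fun a => .inl (Q.refl₁ a)
      trans₂ := by
        rintro a b c (h | h) (h' | h')
        · exact .inl (Q.trans₁ h h')
        · exact hmix h h'
        · exact hmix' h h'
        · exact .inr (Q.trans₂ h' h)
      antisymm₂ := by
        rintro a b (h | h) (h' | h')
        · exact Q.antisymm₁ h h'
        · exact hpl (.inl h) (.inl h')
        · exact hpl (.inr h') (.inr h)
        · exact Q.antisymm₂ h' h }
  obtain ⟨⟨m, R⟩, ⟨e⟩⟩ := SP.exists_std D fun a b => by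
    change (Q.le₁ a b ∨ Q.le₂ b a) ∨ (Q.le₁ b a ∨ Q.le₂ a b)
    have := htot a b
    tauto
  obtain rfl : n = m := Fin.equiv_iff_eq.1 ⟨e.toEquiv⟩
  refine ⟨e.toEquiv, ext_le₁ fun a b => ?_⟩
  have he : e.toEquiv a ≤ e.toEquiv b ↔ (Q.le₁ a b ∨ Q.le₂ b a) :=
    (R.le₂_iff _ _).symm.trans (e.map_le₂ a b)
  change (a ≤ b ∧ e.toEquiv a ≤ e.toEquiv b) ↔ P.poset.le₁ a b
  rw [he, ← P.le₂_iff, h₁, h₂]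
  refine ⟨?_, fun h => ⟨.inl h, .inl h⟩⟩
  rintro ⟨h | h, h' | h'⟩
  · exact h
  · exact h
  · exact h'
  · exact Q.antisymm₂ h h' ▸ Q.refl₁ a

/-- An upper bound suffices, as the images under `theta` will be shown to span a space of dimension
`n!`. -/
theorem card_specialPlane_le (n : ℕ) :
    Nat.card {P : SPn n // (⟨n, P⟩ : SP) ∈ PosetFamily.specialPlane} ≤ n.factorial := by
  rw [← Nat.card_fin n, ← Nat.card_perm, Nat.card_fin]
  exact Nat.card_le_card_of_surjective (fun σ => ⟨planeOfPerm σ, planeOfPerm_mem σ⟩)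
    fun ⟨P, hP⟩ => (exists_planeOfPerm hP).imp fun σ h => Subtype.ext h

open Classical in
/-- The position of the parent of a vertex of a heap-ordered forest, shifted by `1`;
it is `0` for a root. -/
noncomputable def parent (P : SPn n) (i : Fin n) : ℕ :=
  (Finset.univ.filter fun j => j < i ∧ P.poset.le₁ j i).sup fun j => j.1 + 1

theorem parent_lt (P : SPn n) (i : Fin n) : P.parent i < i.1 + 1 := by
  classical
  refine Nat.lt_succ_of_le (Finset.sup_le fun j hj => ?_)
  exact (Finset.mem_filter.1 hj).2.1

theorem le_parent {P : SPn n} {i j : Fin n} (h : j < i) (h' : P.poset.le₁ j i) :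
    j.1 + 1 ≤ P.parent i := by
  classical
  exact Finset.le_sup (f := fun j : Fin n => j.1 + 1) (by simp [h, h'])

theorem exists_parent_eq {P : SPn n} {i : Fin n} (h : P.parent i ≠ 0) :
    ∃ j, j < i ∧ P.poset.le₁ j i ∧ P.parent i = j.1 + 1 := by
  classical
  have hne : (Finset.univ.filter fun j => j < i ∧ P.poset.le₁ j i).Nonempty := by
    rw [Finset.nonempty_iff_ne_empty]
    intro he
    exact h (by rw [parent, he, Finset.sup_empty]; rfl)
  obtain ⟨j, hj, h⟩ := Finset.exists_mem_eq_sup _ hne fun j : Fin n => j.1 + 1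
  simp only [Finset.mem_filter, Finset.mem_univ, true_and] at hj
  exact ⟨j, hj.1, hj.2, h⟩

/-- In a heap-ordered forest, what is strictly below `b` is comparable with the parent of `b`, and
that parent is the largest predecessor of `b`. So a relation `a ≤₁ b` factors through the parent,
and strong induction on `b` carries it over to `Q`. -/
theorem le₁_of_parent_eq {P Q : SPn n}
    (hP : (⟨n, P⟩ : SP) ∈ PosetFamily.heapOrderedForest) (h : P.parent = Q.parent)
    (b a : Fin n) (hab : P.poset.le₁ a b) : Q.poset.le₁ a b := by
  have hheap : ∀ {a b}, P.poset.le₁ a b → a ≤ b := fun h => (P.le₂_iff _ _).1 (hP.1 _ _ h)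
  induction b using WellFoundedLT.induction generalizing a with
  | _ b ih =>
  by_cases hne : a = b
  · exact hne ▸ Q.poset.refl₁ a
  have hlt : a < b := lt_of_le_of_ne (hheap hab) hne
  have hpos : P.parent b ≠ 0 := by
    have := le_parent hlt hab
    omega
  obtain ⟨c, hcb, hcb', hc⟩ := exists_parent_eq hpos
  obtain ⟨c', -, hc'', hc'⟩ := exists_parent_eq (h ▸ hpos)
  obtain rfl : c = c' := Fin.ext (by rw [← h] at hc'; omega)
  have hac : a ≤ c := by
    have := le_parent hlt hab
    rw [Fin.le_def]
    omega
  refine Q.poset.trans₁ (ih c hcb a ?_) hc''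
  rcases hP.2 a c b hab hcb' with h | h
  · exact h
  · exact le_antisymm hac (hheap h) ▸ P.poset.refl₁ a

/-- A forest is determined by its parent function, which takes at most `i + 1` values at vertex `i`:
the root marker `0` and the `i` smaller vertices shifted by `1`. The product of these numbers is
`n!`. -/
theorem card_heapOrderedForest_le (n : ℕ) :
    Nat.card {P : SPn n // (⟨n, P⟩ : SP) ∈ PosetFamily.heapOrderedForest} ≤ n.factorial := by
  have hcard : Nat.card (∀ i : Fin n, Fin (i.1 + 1)) = n.factorial := by
    rw [Nat.card_eq_fintype_card, Fintype.card_pi]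
    simp only [Fintype.card_fin]
    rw [Fin.prod_univ_eq_prod_range (fun i => i + 1), Finset.prod_range_add_one_eq_factorial]
  rw [← hcard]
  refine Nat.card_le_card_of_injective (fun P i => ⟨P.1.parent i, P.1.parent_lt i⟩) ?_
  rintro ⟨P, hP⟩ ⟨Q, hQ⟩ h
  have h : P.parent = Q.parent := by
    funext i
    exact congrArg Fin.val (congrFun h i)
  exact Subtype.ext (ext_le₁ fun a b =>
    ⟨le₁_of_parent_eq hP h b a, le₁_of_parent_eq hQ h.symm b a⟩)

end SPn

/-! ### Bijectivity of `theta` on forests and on plane posets -/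

namespace HAlg

variable {K : Type*}

open Classical in
theorem theta_apply [CommRing K] {C : PosetFamily} {n : ℕ} [Fintype {P : SPn n // (⟨n, P⟩ : SP) ∈ C}]
    (x : HAlg K C) (σ : Equiv.Perm (Fin n)) : theta K C x ⟨n, σ⟩ =
      ∑ P : {P : SPn n // (⟨n, P⟩ : SP) ∈ C},
        (basis K C).repr x ⟨⟨n, P.1⟩, P.2⟩ * P.1.ext K σ := by
  induction x using HAlg.induction with
  | of P hP =>
    rw [← basis_apply K ⟨P, hP⟩, (basis K C).repr_self, basis_apply]
    obtain ⟨m, P⟩ := P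
    by_cases h : m = n
    · subst h
      rw [theta_of_apply, Finset.sum_eq_single ⟨P, hP⟩]
      · simp
      · rintro ⟨Q, hQ⟩ _ hne
        rw [Finsupp.single_eq_of_ne, zero_mul]
        intro h
        apply hne
        cases h
        rfl
      · simp
    · rw [theta_of_apply_of_ne _ _ h, Finset.sum_eq_zero]
      rintro ⟨Q, hQ⟩ _
      rw [Finsupp.single_eq_of_ne, zero_mul]
      intro h'
      exact h (congrArg (fun P => P.1.card) h').symm
  | add x y hx hy => simp only [map_add, Finsupp.add_apply, hx, hy, add_mul, Finset.sum_add_distrib]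
  | smul a x hx =>
    simp only [map_smul, Finsupp.smul_apply, hx, smul_eq_mul, mul_assoc, Finset.mul_sum]

section

variable [Field K] {C : PosetFamily}

/-- When there are not too many posets in each degree and `theta` is surjective, the sums of linear
extensions are linearly independent. -/
theorem repr_eq_zero_of_theta
    (hcard : ∀ n, Nat.card {P : SPn n // (⟨n, P⟩ : SP) ∈ C} ≤ n.factorial)
    (hsurj : ∀ s, Finsupp.single s 1 ∈ LinearMap.range (theta K C)) {n : ℕ} {x : HAlg K C}
    (hx : ∀ σ : Equiv.Perm (Fin n), theta K C x ⟨n, σ⟩ = 0) (P : SPn n) (hP : (⟨n, P⟩ : SP) ∈ C) :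
    (basis K C).repr x ⟨⟨n, P⟩, hP⟩ = 0 := by
  classical
  let _ : Fintype {P : SPn n // (⟨n, P⟩ : SP) ∈ C} := Fintype.ofFinite _
  let v : {P : SPn n // (⟨n, P⟩ : SP) ∈ C} → Equiv.Perm (Fin n) → K := fun P => P.1.ext K
  have hv : ∀ y : HAlg K C, ∑ P, (basis K C).repr y ⟨⟨n, P.1⟩, P.2⟩ • v P =
      fun σ => theta K C y ⟨n, σ⟩ := by
    intro y
    funext σ
    rw [theta_apply, Finset.sum_apply]
    rfl
  have hspan : ⊤ ≤ Submodule.span K (Set.range v) := by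
    rw [← (Pi.basisFun K (Equiv.Perm (Fin n))).span_eq, Submodule.span_le]
    rintro _ ⟨σ, rfl⟩
    obtain ⟨y, hy⟩ := hsurj ⟨n, σ⟩
    have : Pi.basisFun K (Equiv.Perm (Fin n)) σ = fun τ => theta K C y ⟨n, τ⟩ := by
      funext τ
      rw [hy, Pi.basisFun_apply, Pi.single_apply, Finsupp.single_apply]
      exact if_congr ⟨fun h => h ▸ rfl, fun h => by cases h; rfl⟩ rfl rfl
    rw [SetLike.mem_coe, this, ← hv]
    exact Submodule.sum_mem _ fun P _ =>
      Submodule.smul_mem _ _ (Submodule.subset_span ⟨P, rfl⟩)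
  -- The family spans the functions on permutations and has at most as many members as their
  -- dimension `n!`, so it is independent.
  have hli : LinearIndependent K v := by
    refine linearIndependent_of_top_le_span_of_card_le_finrank hspan ?_
    rw [Module.finrank_fintype_fun_eq_card, Fintype.card_perm, Fintype.card_fin,
      ← Nat.card_eq_fintype_card]
    exact hcard n
  refine Fintype.linearIndependent_iff.1 hli _ ((hv x).trans ?_) ⟨P, hP⟩
  funext σ
  exact hx σ

theorem theta_bijective (hcard : ∀ n, Nat.card {P : SPn n // (⟨n, P⟩ : SP) ∈ C} ≤ n.factorial)
    (hsurj : ∀ s, Finsupp.single s 1 ∈ LinearMap.range (theta K C)) :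
    Function.Bijective (theta K C) := by
  constructor
  · refine (injective_iff_map_eq_zero _).2 fun x hx => (basis K C).ext_elem fun ⟨⟨n, P⟩, hP⟩ => ?_
    rw [repr_eq_zero_of_theta hcard hsurj (fun σ => by rw [hx]; rfl) P hP, map_zero]
    rfl
  · rw [← LinearMap.range_eq_top, ← top_le_iff, ← (Finsupp.basisSingleOne (R := K)).span_eq,
      Submodule.span_le]
    rintro _ ⟨s, rfl⟩
    rw [Finsupp.coe_basisSingleOne]
    exact hsurj s

/-- The independence holds degree by degree, so the degree of `x` can be read on `theta`. Hence a
map compatible with `theta` respects the gradings in both directions. -/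
theorem mem_homogeneous_iff
    (hcard : ∀ n, Nat.card {P : SPn n // (⟨n, P⟩ : SP) ∈ C} ≤ n.factorial)
    (hsurj : ∀ s, Finsupp.single s 1 ∈ LinearMap.range (theta K C)) {n : ℕ} {x : HAlg K C} :
    x ∈ homogeneous K C n ↔ ∀ m (σ : Equiv.Perm (Fin m)), m ≠ n → theta K C x ⟨m, σ⟩ = 0 := by
  constructor
  · intro hx m σ hm
    induction hx using Submodule.span_induction with
    | mem x hx =>
      obtain ⟨P, hP, h, rfl⟩ := hx
      exact theta_of_apply_of_ne _ _ (h.trans_ne hm.symm) _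
    | zero => rw [map_zero]; rfl
    | add x y _ _ hx hy => rw [map_add, Finsupp.add_apply, hx, hy, add_zero]
    | smul a x _ hx => rw [map_smul, Finsupp.smul_apply, hx, smul_zero]
  · intro h
    rw [← (basis K C).linearCombination_repr x, Finsupp.linearCombination_apply]
    refine Submodule.sum_mem _ fun ⟨⟨m, P⟩, hP⟩ hmem => Submodule.smul_mem _ _ ?_
    refine Submodule.subset_span ⟨_, hP, ?_, rfl⟩
    by_contra hm
    exact Finsupp.mem_support_iff.1 hmem
      (repr_eq_zero_of_theta hcard hsurj (fun σ => h m σ hm) P hP)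

end

variable (K)

/-- A total order has a single linear extension. -/
theorem theta_ofPerm [CommRing K] {n : ℕ} (σ : Equiv.Perm (Fin n)) :
    theta K .special (of K ⟨n, SPn.ofPerm σ⟩ (PosetFamily.mem_special _)) =
      Finsupp.single ⟨n, σ⟩ 1 := by
  classical
  ext ⟨m, τ⟩
  by_cases hm : n = m
  · subst hm
    rw [theta_of_apply, SPn.ext_eq_ite K (SPn.isExtension_ofPerm σ τ)]
    by_cases h : τ = σ
    · rw [if_pos h, h, Finsupp.single_eq_same]
    · rw [if_neg h, Finsupp.single_eq_of_ne]
      exact fun h' => h (by cases h'; rfl)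
  · rw [theta_of_apply_of_ne _ _ hm, Finsupp.single_eq_of_ne]
    exact fun h => hm (congrArg Sigma.fst h).symm

theorem single_mem_range_theta_heapOrderedForest [CommRing K] (s : Σ n, Equiv.Perm (Fin n)) :
    Finsupp.single s 1 ∈ LinearMap.range (theta K .heapOrderedForest) := by
  obtain ⟨x, hx⟩ := Reduces.exists K (SPn.ofPerm s.2)
  exact ⟨x, (theta_eq_of_reduces hx).trans (theta_ofPerm K s.2)⟩

/-- Triangularity: the linear extensions of `planeOfPerm σ` are the permutations whose inversions
are all inversions of `σ`. One of them is `σ`, and the others have strictly fewer inversions, so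
induction on the number of inversions applies. -/
theorem single_mem_range_theta_specialPlane [CommRing K] (s : Σ n, Equiv.Perm (Fin n)) :
    Finsupp.single s 1 ∈ LinearMap.range (theta K .specialPlane) := by
  classical
  obtain ⟨n, σ⟩ := s
  let inversions : Equiv.Perm (Fin n) → Finset (Fin n × Fin n) := fun σ =>
    Finset.univ.filter fun x => x.1 ≤ x.2 ∧ ¬ σ x.1 ≤ σ x.2
  induction hk : (inversions σ).card using Nat.strong_induction_on generalizing σ with
  | _ k ih =>
  subst hk
  let S : Finset (Equiv.Perm (Fin n)) :=
    Finset.univ.filter fun τ => (SPn.planeOfPerm σ).IsExtension τ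
  have hσ : σ ∈ S := by
    simp only [S, Finset.mem_filter, Finset.mem_univ, true_and]
    exact fun a b h => h.2
  have htheta : theta K .specialPlane (of K _ (SPn.planeOfPerm_mem σ)) =
      ∑ τ ∈ S, Finsupp.single ⟨n, τ⟩ 1 := by
    ext ⟨m, τ⟩
    rw [Finsupp.finsetSum_apply]
    by_cases hm : n = m
    · subst hm
      rw [theta_of_apply, SPn.ext]
      simp only [Finsupp.single_apply, Sigma.mk.injEq, heq_eq_eq, true_and,
        Finset.sum_ite_eq']
      exact if_congr (by simp [S]) rfl rfl
    · rw [theta_of_apply_of_ne _ _ hm, Finset.sum_eq_zero]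
      intro ρ _
      rw [Finsupp.single_eq_of_ne]
      exact fun h => hm (congrArg Sigma.fst h).symm
  rw [← Finset.add_sum_erase S _ hσ] at htheta
  rw [eq_sub_of_add_eq htheta.symm]
  refine Submodule.sub_mem _ ⟨_, rfl⟩ (Submodule.sum_mem _ fun τ hτ => ih _ ?_ τ rfl)
  rw [Finset.mem_erase] at hτ
  have hext : ∀ a b, a ≤ b → σ a ≤ σ b → τ a ≤ τ b := fun a b h h' =>
    (Finset.mem_filter.1 hτ.2).2 a b ⟨h, h'⟩
  have hsub : inversions τ ⊆ inversions σ := by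
    intro x
    simp only [inversions, Finset.mem_filter, Finset.mem_univ, true_and]
    exact fun h => ⟨h.1, fun h' => h.2 (hext _ _ h.1 h')⟩
  refine Finset.card_lt_card (hsub.ssubset_of_ne fun h => hτ.1 ?_)
  -- If the inversion sets coincide, the implication `hext` is reversible, so `σ` and `τ` order all
  -- pairs alike and are equal.
  have h : ∀ a b, a ≤ b → τ a ≤ τ b → σ a ≤ σ b := by
    intro a b hab hle
    by_contra hnot
    have : (a, b) ∈ inversions τ := by
      rw [h]
      simpa [inversions, hab] using hnot
    exact (Finset.mem_filter.1 this).2.2 hle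
  refine Equiv.Perm.eq_of_forall_le fun a b hab => ?_
  rcases le_total a b with hle | hle
  · exact hext a b hle hab
  · by_contra hnot
    have h' := h b a hle (le_of_not_ge hnot)
    exact hnot (le_of_eq (congrArg τ (σ.injective (le_antisymm hab h'))))

end HAlg

/-! ### Compatibility with the antipode -/

/-- A morphism of bialgebras between two Hopf algebras preserves the antipode. -/
theorem BialgEquiv.map_antipode {K A B : Type*} [CommRing K] [Ring A] [Ring B] [HopfAlgebra K A]
    [HopfAlgebra K B] (e : A ≃ₐc[K] B) (x : A) :
    e (HopfAlgebra.antipode K x) = HopfAlgebra.antipode K (e x) := by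
  open WithConv in
  let E : A →ₗ[K] B := (e.toAlgEquiv : A ≃ₐ[K] B).toLinearMap
  have hcomul : ∀ a, Coalgebra.comul (R := K) (E a) = TensorProduct.map E E (Coalgebra.comul a) :=
    fun a => (CoalgHomClass.map_comp_comul_apply e a).symm
  have hcounit : ∀ a, Coalgebra.counit (R := K) (E a) = Coalgebra.counit (R := K) a :=
    fun a => CoalgHomClass.counit_comp_apply e a
  have hmul : E ∘ₗ LinearMap.mul' K A = LinearMap.mul' K B ∘ₗ TensorProduct.map E E := by
    ext a b
    exact map_mul e a b
  have halg : ∀ r : K, E (algebraMap K A r) = algebraMap K B r := fun r => AlgHomClass.commutes e r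
  -- In the convolution algebra of maps from `A` to `B`, the antipode followed by `E` is a left
  -- inverse of `E`, and `E` followed by the antipode is a right inverse; the two therefore
  -- coincide.
  have hl : toConv (E ∘ₗ HopfAlgebra.antipode K (A := A)) * toConv E = 1 := by
    ext a
    rw [LinearMap.convMul_apply, LinearMap.convOne_apply, ← halg,
      ← HopfAlgebra.mul_antipode_rTensor_comul_apply, ← LinearMap.comp_apply E, hmul]
    rw [LinearMap.comp_apply, LinearMap.rTensor, ← LinearMap.comp_apply (TensorProduct.map E E),
      ← TensorProduct.map_comp, LinearMap.comp_id]
  have hr : toConv E * toConv (HopfAlgebra.antipode K (A := B) ∘ₗ E) = 1 := by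
    ext a
    rw [LinearMap.convMul_apply, LinearMap.convOne_apply, ← hcounit,
      ← HopfAlgebra.mul_antipode_lTensor_comul_apply, hcomul, LinearMap.lTensor,
      ← LinearMap.comp_apply (TensorProduct.map _ _) (TensorProduct.map E E),
      ← TensorProduct.map_comp, LinearMap.id_comp]
  exact LinearMap.congr_fun (congrArg ofConv (left_inv_eq_right_inv hl hr)) x

/-! ### The isomorphism of bialgebras -/

namespace HAlg

open PermSpace

variable (K : Type*) [Field K]

theorem theta_heapOrderedForest_bijective : Function.Bijective (theta K .heapOrderedForest) :=
  theta_bijective SPn.card_heapOrderedForest_le (single_mem_range_theta_heapOrderedForest K)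

theorem theta_specialPlane_bijective : Function.Bijective (theta K .specialPlane) :=
  theta_bijective SPn.card_specialPlane_le (single_mem_range_theta_specialPlane K)

/-- The expression of a sum of permutations in terms of heap-ordered forests. -/
noncomputable def thetaEquiv : HHOF K ≃ₗ[K] PermSpace K :=
  LinearEquiv.ofBijective (theta K .heapOrderedForest) (theta_heapOrderedForest_bijective K)

variable {K}

theorem theta_thetaEquiv_symm (f : PermSpace K) :
    theta K .heapOrderedForest ((thetaEquiv K).symm f) = f :=
  (thetaEquiv K).apply_symm_apply f

/-- A linear map compatible with `theta` is a morphism of coalgebras. -/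
theorem comul_eq_of_theta_eq {C C' : PosetFamily} (h : Function.Bijective (theta K C))
    (u : HAlg K C' →ₗ[K] HAlg K C) (hu : ∀ x, theta K C (u x) = theta K C' x) (x : HAlg K C') :
    Coalgebra.comul (u x) = TensorProduct.map u u (Coalgebra.comul (R := K) x) := by
  have hinj : Function.Injective (TensorProduct.map (theta K C) (theta K C)) :=
    (TensorProduct.congr (LinearEquiv.ofBijective _ h) (LinearEquiv.ofBijective _ h)).injective
  have hcomp : theta K C ∘ₗ u = theta K C' := LinearMap.ext hu
  -- Test against pairs `theta y`, `theta z`, which fill the whole space: by adjunction both sides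
  -- become the form of `theta (y * z)` with `theta x`.
  refine hinj (tensor_eq_of_form fun f g => ?_)
  obtain ⟨y, rfl⟩ := h.2 f
  obtain ⟨z, rfl⟩ := h.2 g
  rw [tmulForm_map, tmulForm_map, tmulForm_map, LinearMap.comp_assoc, LinearMap.comp_assoc, hcomp,
    ← form_theta_mul, ← form_theta_mul, hu]

/-- A linear map compatible with `theta` is a morphism of algebras. -/
theorem mul_eq_of_theta_eq {C C' : PosetFamily} (h : Function.Bijective (theta K C))
    (u : HAlg K C' →ₗ[K] HAlg K C) (hu : ∀ x, theta K C (u x) = theta K C' x) (x y : HAlg K C') :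
    u (x * y) = u x * u y := by
  refine h.1 (eq_of_form_left fun g => ?_)
  obtain ⟨z, rfl⟩ := h.2 g
  rw [hu, form_theta_mul, form_theta_mul, hu, hu]

variable (K) in
/-- The isomorphism of bialgebras between special plane posets and heap-ordered forests. -/
noncomputable def planeEquiv : HSPP K ≃ₐc[K] HHOF K :=
  let u : HSPP K ≃ₗ[K] HHOF K :=
    (LinearEquiv.ofBijective (theta K .specialPlane) (theta_specialPlane_bijective K)).trans
      (thetaEquiv K).symm
  have hu (x) : theta K .heapOrderedForest (u x) = theta K .specialPlane x :=
    theta_thetaEquiv_symm _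
  BialgEquiv.ofAlgEquiv
    (AlgEquiv.ofLinearEquiv u
      ((theta_heapOrderedForest_bijective K).1 ((hu 1).trans theta_one_eq))
      (mul_eq_of_theta_eq (theta_heapOrderedForest_bijective K) u.toLinearMap hu))
    (AlgHom.ext fun x => by
      change Coalgebra.counit (u x) = Coalgebra.counit x
      rw [← theta_apply_zero, ← theta_apply_zero, hu])
    (AlgHom.ext fun x =>
      (comul_eq_of_theta_eq (theta_heapOrderedForest_bijective K) u.toLinearMap hu x).symm)

theorem theta_planeEquiv (x : HSPP K) :
    theta K .heapOrderedForest (planeEquiv K x) = theta K .specialPlane x :=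
  theta_thetaEquiv_symm _

end HAlg

/-! ### The theorem -/

open HAlg PermSpace

theorem corollary26 (K : Type*) [Field K] :
    -- `Υ` maps a special poset to the result of the two transformations, which exists and does not
    -- depend on the way the transformations are performed.
    ∃ Υ : HSP K →ₗ[K] HHOF K,
      (∀ (n : ℕ) (P : SPn n) (x : HHOF K),
        Reduces K P x ↔ x = Υ (HAlg.of K ⟨n, P⟩ (PosetFamily.mem_special _))) ∧
      -- The restriction of `Υ` is an isomorphism of graded Hopf algebras and an isometry.
      (∃ e : HSPP K ≃ₐc[K] HHOF K,
        (∀ x, e x = Υ (HAlg.incl K .specialPlane x)) ∧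
        (∀ x, e (HopfAlgebra.antipode K x) = HopfAlgebra.antipode K (e x)) ∧
        (∀ n x, e x ∈ HAlg.homogeneous K .heapOrderedForest n ↔
          x ∈ HAlg.homogeneous K .specialPlane n) ∧
        (∀ x y, HAlg.pairingOn K .heapOrderedForest (e x) (e y) =
          HAlg.pairingOn K .specialPlane x y)) ∧
      -- The pairing restricted to heap-ordered forests is nondegenerate.
      (HAlg.pairingOn K .heapOrderedForest).Nondegenerate := by
  have hinj := (theta_heapOrderedForest_bijective K).1
  have hsurj := (theta_heapOrderedForest_bijective K).2
  let Υ : HSP K →ₗ[K] HHOF K := (thetaEquiv K).symm.toLinearMap ∘ₗ theta K .special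
  have hΥ (x) : theta K .heapOrderedForest (Υ x) = theta K .special x := theta_thetaEquiv_symm _
  refine ⟨Υ, fun n P x => ?_, ⟨planeEquiv K, fun x => hinj ?_, BialgEquiv.map_antipode _,
    fun n x => ?_, fun x y => ?_⟩, fun x hx => hinj ?_, fun x hx => hinj ?_⟩
  · have key : ∀ y, Reduces K P y → y = Υ (of K ⟨n, P⟩ (PosetFamily.mem_special _)) := fun y hy =>
      hinj ((theta_eq_of_reduces hy).trans (hΥ _).symm)
    obtain ⟨y, hy⟩ := Reduces.exists K P
    exact ⟨key x, fun h => (h.trans (key y hy).symm) ▸ hy⟩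
  · rw [theta_planeEquiv, hΥ, theta_incl]
  · rw [mem_homogeneous_iff SPn.card_heapOrderedForest_le
        (single_mem_range_theta_heapOrderedForest K),
      mem_homogeneous_iff SPn.card_specialPlane_le (single_mem_range_theta_specialPlane K),
      theta_planeEquiv]
  · rw [pairingOn_eq, pairingOn_eq, theta_planeEquiv, theta_planeEquiv]
  -- Every `z` is `theta y` for a combination of forests `y`, so orthogonality to all forests is
  -- orthogonality to the whole space of permutations.
  · refine eq_of_form_left fun z => ?_
    obtain ⟨y, rfl⟩ := hsurj z
    rw [← pairingOn_eq, hx, map_zero, map_zero]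
    rfl
  · refine eq_of_form_right fun z => ?_
    obtain ⟨y, rfl⟩ := hsurj z
    rw [← pairingOn_eq, hx, map_zero, map_zero]
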